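/- Consider $N\ge 1$ qubits with collective spin components $J_\alpha=\tfrac12\sum_{k=1}^N\sigma_\alpha^{(k)}$, $\alpha\in\{x,y,z\}$, subject to the frequency signal $b\in\mathbb R$ and to classical collective dephasing, $H_0(s)=J_z\,[b+\xi(s)]$. Here $\xi$ is a zero-mean stationary Gaussian process with (measurable sample paths and) autocorrelation $$\langle \xi(s)\xi(s')\rangle=C(s-s'),\qquad C(\tau)=\frac1{2\pi}\int_{-\infty}^\infty S(\omega)e^{i\omega\tau}\,d\omega ,\qquad S(\omega)=\omega_c\,\sigma(\omega/\omega_c),$$ where $\omega_c>0$ and the dimensionless spectral profile $\sigma\ge 0$ is even, integrable and not almost everywhere zero (colored noise). During one shot of duration $t$, collective open-loop control is applied in the form of $Q\ge 0$ instantaneous pulses $e^{-i\theta_k O_k}$ at arbitrary times $0<t_1<\dots<t_Q<t$, where the angles $\theta_k$ are real and arbitrary and each $O_k$ is an arbitrary Hermitian element of the algebra generated by $J_x,J_y,J_z$; put $t_0=0$, $t_{Q+1}=t$, so that there are $Q'=Q+1$ free-evolution segments. For an arbitrary input density matrix $\rho_0$ of the $N$ qubits, the output state is the noise average $$\rho_b(t)=\big\langle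 U_\xi\,\rho_0\,U_\xi^\dagger\big\rangle,\qquad U_\xi=e^{-i\phi_Q J_z}\,e^{-i\theta_Q O_Q}\,e^{-i\phi_{Q-1}J_z}\cdots e^{-i\theta_1 O_1}\,e^{-i\phi_0J_z},\qquad \phi_j=b\,(t_{j+1}-t_j)+\int_{t_j}^{t_{j+1}}\xi(s)\,ds .$$ Let $$F_Q[\rho_b]=2\sum_{\lambda_i+\lambda_j>0}\frac{|\langle i|\partial_b\rho_b|j\rangle|^2}{\lambda_i+\lambda_j}$$ be the quantum Fisher information ($\lambda_i,|i\rangle$ the eigenvalues and an orthonormal basis of eigenvectors of $\rho_b$). For a total runtime $T>0$, let $F_Q^{\rm tot}=\frac Tt F_Q[\rho_b(t)]$ be the total quantum Fisher information of the $T/t$ repetitions, and let $\Delta\hat b^2_{\rm QCRB}=1/F_Q^{\rm tot}$ be the quantum Cramér–Rao bound ($=\infty$ if $F_Q^{\rm tot}=0$). Then arbitrary collective open-loop control cannot beat the standard-quantum-limit scaling in the short-time regime: for every spectral profile $\sigma$ there are dimensionless constants $K_1,K_2,\dots>0$ such that, for all $\omega_c$, $N$, $Q$, all pulse sequences (instants,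 angles and generators) with $\omega_c t\le 1$, all input states $\rho_0$, all $T>0$ and all $b$, $\rho_b(t)$ is a density matrix, differentiable in $b$, and $$F_Q^{\rm tot}\;\le\;\frac{T}{\omega_c}\,K_{Q'}^{1/2}\,N,\qquad\qquad \Delta\hat b^2_{\rm QCRB}\;\ge\;\frac{\omega_c}{T}\,K_{Q'}^{-1/2}\,N^{-1}.$$ For a given spectral profile, the constant $K_{Q'}$ thus depends only on the number $Q'$ of segments. -/

import Mathlib

open MeasureTheory ProbabilityTheory
open scoped ComplexOrder

noncomputable section

namespace CollectiveDephasing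

/-! ## The `N`-qubit probe and its collective spin -/

/-- Labels of the computational basis of `N` qubits. -/
abbrev Idx (N : ℕ) : Type := Fin N → Fin 2

/-- Operators on the `N`-qubit Hilbert space, as matrices in the computational basis. -/
abbrev Op (N : ℕ) : Type := Matrix (Idx N) (Idx N) ℂ

/-- Pauli matrix `σ_x`. -/
def pauliX : Matrix (Fin 2) (Fin 2) ℂ := !![0, 1; 1, 0]

/-- Pauli matrix `σ_y`. -/
def pauliY : Matrix (Fin 2) (Fin 2) ℂ := !![0, -Complex.I; Complex.I, 0]

/-- Pauli matrix `σ_z`. -/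
def pauliZ : Matrix (Fin 2) (Fin 2) ℂ := !![1, 0; 0, -1]

/-- The single-qubit operator `A` acting on qubit `k` (tensored with identities elsewhere). -/
def onSite {N : ℕ} (A : Matrix (Fin 2) (Fin 2) ℂ) (k : Fin N) : Op N :=
  Matrix.of fun x y => if ∀ l, l ≠ k → x l = y l then A (x k) (y k) else 0

/-- The collective operator `½ ∑ₖ A⁽ᵏ⁾`. -/
def collective (N : ℕ) (A : Matrix (Fin 2) (Fin 2) ℂ) : Op N :=
  (1 / 2 : ℂ) • ∑ k : Fin N, onSite A k

/-- Collective spin component `J_x`. -/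
def Jx (N : ℕ) : Op N := collective N pauliX

/-- Collective spin component `J_y`. -/
def Jy (N : ℕ) : Op N := collective N pauliY

/-- Collective spin component `J_z`. -/
def Jz (N : ℕ) : Op N := collective N pauliZ

/-- The collective operators: all (noncommutative polynomial) functions of `J_x, J_y, J_z`. -/
def collectiveAlgebra (N : ℕ) : Subalgebra ℂ (Op N) :=
  Algebra.adjoin ℂ {Jx N, Jy N, Jz N}

/-- Density matrices: positive semidefinite with unit trace. -/
def IsDensity {n : Type*} [Fintype n] (ρ : Matrix n n ℂ) : Prop :=
  ρ.PosSemidef ∧ ρ.trace = 1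

/-- The unitary `e^{-i θ A}`. -/
def unitaryExp {N : ℕ} (θ : ℝ) (A : Op N) : Op N :=
  NormedSpace.exp ((-(Complex.I * (θ : ℂ))) • A)

/-! ## Open-loop collective control by instantaneous pulses -/

/-- A sequence of `Q` instantaneous collective pulses applied during one shot.
The instants are `0 = t₀ < t₁ < ⋯ < t_Q < t_{Q+1} = t`; the pulse applied at `t_{k+1}` is
`exp (-i θₖ Oₖ)`, where `Oₖ` is a Hermitian function of the collective spin components. -/
structure PulseSequence (N Q : ℕ) where
  /-- the instants `t₀, …, t_{Q+1}` -/
  time : Fin (Q + 2) → ℝ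
  time_zero : time 0 = 0
  time_strictMono : StrictMono time
  /-- the pulse generators -/
  gen : Fin Q → Op N
  gen_hermitian : ∀ k, (gen k).IsHermitian
  gen_collective : ∀ k, gen k ∈ collectiveAlgebra N
  /-- the rotation angles -/
  angle : Fin Q → ℝ

/-- The duration `t` of the shot. -/
def PulseSequence.duration {N Q : ℕ} (c : PulseSequence N Q) : ℝ := c.time (Fin.last (Q + 1))

/-- The `k`-th pulse unitary. -/
def PulseSequence.pulse {N Q : ℕ} (c : PulseSequence N Q) (k : Fin Q) : Op N :=
  unitaryExp (c.angle k) (c.gen k)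

/-- The ordered product
`e^{-i φ_Q J_z} V_{Q-1} e^{-i φ_{Q-1} J_z} ⋯ V₀ e^{-i φ₀ J_z}` of free precessions with phases `φⱼ`
and pulses `Vₖ`. -/
def propagator {N : ℕ} : (Q : ℕ) → (Fin Q → Op N) → (Fin (Q + 1) → ℝ) → Op N
  | 0, _, φ => unitaryExp (φ 0) (Jz N)
  | Q + 1, V, φ =>
      unitaryExp (φ (Fin.last (Q + 1))) (Jz N) * V (Fin.last Q) *
        propagator Q (fun k => V k.castSucc) (fun j => φ j.castSucc)

/-! ## Stationary coloured Gaussian noise -/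

/-- A dimensionless spectral profile: a nonnegative even integrable function that does not vanish
almost everywhere. -/
structure IsSpectralProfile (σ : ℝ → ℝ) : Prop where
  nonneg : ∀ x, 0 ≤ σ x
  even : ∀ x, σ (-x) = σ x
  integrable : Integrable σ
  not_ae_zero : ¬ (∀ᵐ x, σ x = 0)

/-- The power spectral density `S(ω) = ω_c σ(ω / ω_c)` with profile `σ` and cutoff frequency
`ω_c`. -/
def noiseSpectrum (σ : ℝ → ℝ) (ωc : ℝ) (w : ℝ) : ℝ := ωc * σ (w / ωc)

/-- The autocorrelation function `C(τ) = (2π)⁻¹ ∫ S(ω) e^{iωτ} dω` (`S` being even). -/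
def correlation (S : ℝ → ℝ) (τ : ℝ) : ℝ :=
  (2 * Real.pi)⁻¹ * ∫ w, S w * Real.cos (w * τ)

/-- `ξ` is a zero-mean Gaussian process on the probability space `(Ω, P)`, stationary with power
spectral density `S`. -/
structure IsStationaryGaussianNoise {Ω : Type*} [MeasurableSpace Ω] (P : Measure Ω)
    (ξ : ℝ → Ω → ℝ) (S : ℝ → ℝ) : Prop where
  measurable : Measurable (Function.uncurry ξ)
  gaussian : IsGaussianProcess ξ P
  mean_zero : ∀ s, ∫ x, ξ s x ∂P = 0
  covariance : ∀ s s', ∫ x, ξ s x * ξ s' x ∂P = correlation S (s - s')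

/-! ## The noise-averaged output state -/

/-- The total phase accumulated during the `j`-th segment along the noise trajectory `x`, namely
`b Δtⱼ + ∫ ξ(s) ds`, the integral being over that segment. -/
def segmentPhase {Ω : Type*} {N Q : ℕ} (c : PulseSequence N Q) (ξ : ℝ → Ω → ℝ) (b : ℝ) (x : Ω)
    (j : Fin (Q + 1)) : ℝ :=
  b * (c.time j.succ - c.time j.castSucc) + ∫ s in (c.time j.castSucc)..(c.time j.succ), ξ s x

/-- The evolution operator along the noise trajectory `x`, generated by
`J_z (b + ξ(s))` between the pulses. -/
def trajectoryUnitary {Ω : Type*} {N Q : ℕ} (c : PulseSequence N Q) (ξ : ℝ → Ω → ℝ) (b : ℝ)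
    (x : Ω) : Op N :=
  propagator Q c.pulse (segmentPhase c ξ b x)

/-- The output state `ρ_b(t)`, the average of `U ρ₀ U†` over the noise trajectories. -/
def outputState {Ω : Type*} [MeasurableSpace Ω] {N Q : ℕ} (P : Measure Ω) (c : PulseSequence N Q)
    (ξ : ℝ → Ω → ℝ) (ρ₀ : Op N) (b : ℝ) : Op N :=
  Matrix.of fun i j =>
    ∫ x, (trajectoryUnitary c ξ b x * ρ₀ * (trajectoryUnitary c ξ b x).conjTranspose) i j ∂P

/-! ## Quantum Fisher information -/

/-- Entrywise derivative of a matrix family. -/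
def matDeriv {n : Type*} (ρ : ℝ → Matrix n n ℂ) (b : ℝ) : Matrix n n ℂ :=
  Matrix.of fun i j => deriv (fun b' => ρ b' i j) b

open Classical in
/-- The quantum Fisher information of the family `ρ` at `b`,
`2 ∑ |⟨i|∂_b ρ_b|j⟩|² / (λᵢ + λⱼ)` over the pairs with `λᵢ + λⱼ > 0`, where `λᵢ, |i⟩` are the
eigenvalues and orthonormal eigenvectors of `ρ_b`. -/
def qfi {n : Type*} [Fintype n] [DecidableEq n] (ρ : ℝ → Matrix n n ℂ) (b : ℝ) : ℝ :=
  if h : (ρ b).IsHermitian then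
    2 * ∑ i, ∑ j, if 0 < h.eigenvalues i + h.eigenvalues j then
      ‖((h.eigenvectorUnitary : Matrix n n ℂ).conjTranspose * matDeriv ρ b *
          (h.eigenvectorUnitary : Matrix n n ℂ)) i j‖ ^ 2 /
        (h.eigenvalues i + h.eigenvalues j)
      else 0
  else 0

/-- The total quantum Fisher information of `T / t` repetitions of a shot of duration `t`. -/
def totalQFI {n : Type*} [Fintype n] [DecidableEq n] (T t : ℝ) (ρ : ℝ → Matrix n n ℂ)
    (b : ℝ) : ℝ :=
  T / t * qfi ρ b

/-- The quantum Cramér-Rao lower bound on the variance of unbiased estimators; it is infinite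
when the quantum Fisher information vanishes. -/
def qcrb {n : Type*} [Fintype n] [DecidableEq n] (T t : ℝ) (ρ : ℝ → Matrix n n ℂ) (b : ℝ) :
    ENNReal :=
  (ENNReal.ofReal (totalQFI T t ρ b))⁻¹

end CollectiveDephasing

end

/-! The Fisher information `F` of one shot obeys two bounds: `F ≤ (t N)²`, the noiseless value, and
`F ≤ K / ω_c²`, which does not involve `N`. The smaller of two squares is at most the product of
their roots, so `F ≤ (√K / ω_c) t N`, and the factor `T / t` cancels `t`.

Both bounds come from one variational inequality, `qfi_le_of_average`: however `∂ρ` is written as an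
average of `U' ρ₀ U† + U ρ₀ U'†`, four times the average of `tr (U' ρ₀ U'†)` dominates `F`. Taking
for `U'` the true derivative of the propagator gives `(t N)²`, since `‖J_z‖ ≤ N / 2` and pulses are
unitary. Taking `U' = (W / 2) U` with a random variable `W` gives the second moment of `W`.

The signal enters only by shifting the Gaussian vector of segment phases by `b Δ`, where `Δ` lists
the segment durations. The state is thus a mixture whose classical weight alone depends on `b`, and
`W` is the score of that shift, a linear form in the noise integrals. It exists with second moment
at most `κ` once `(u·Δ)² ≤ κ Var(u·X)` for all `u` (`exists_represent_of_sq_le`, `exists_score`).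
Entries of the propagator are trigonometric polynomials in the phases, so the score identity is
needed only for characters, where it is Gaussian integration by parts.

What remains is analytic (`exists_mean_sq_le`). In units of `1 / ω_c`, `u·Δ` is the value at
frequency `0` of the Fourier transform of a step function on the unit interval, and the variance is
the energy of that transform weighted by `σ`. The profile may vanish near `0`, and the cells may be
arbitrarily short, so frequency `0` must be recovered, uniformly in the partition, from frequencies
where `σ` is bounded below. For this, the function `s` is interpolated at the partition points by
exponentials with frequencies `(1 + k/m) y`. Taking increments turns this into an expression of the
mean by `n + 1` values of the transform. The coefficients stay bounded even when nodes collide,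
because they come from Newton interpolation of a holomorphic function. For large `m` all these
dilates of `y` stay in a compact set where `σ ≥ δ`, for a set of `y` of positive measure; averaging
over this set gives the estimate. -/

namespace CollectiveDephasing

/-! ## Interpolation by exponentials with controlled coefficients -/

/-- Newton interpolation of a bounded holomorphic function at nodes near the centre of its disc,
with coefficients bounded uniformly in the nodes. -/
lemma exists_interpolating_polynomial (n : ℕ) (η : ℝ) (hη : 0 < η) (hη1 : η ≤ 1) (M : ℝ)
    (hM : 0 ≤ M) :
    ∃ B : ℝ, 0 ≤ B ∧ ∀ f : ℂ → ℂ, DifferentiableOn ℂ f (Metric.ball 1 ((2 * n + 1) * η)) →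
      (∀ z ∈ Metric.ball (1 : ℂ) ((2 * n + 1) * η), ‖f z‖ ≤ M) →
      ∀ z : Fin (n + 1) → ℂ, (∀ j, z j ∈ Metric.ball (1 : ℂ) η) →
      ∃ p : Polynomial ℂ, p.natDegree ≤ n ∧ (∀ k, ‖p.coeff k‖ ≤ B) ∧
        ∀ j, p.eval (z j) = f (z j) := by
  induction n generalizing M with
  | zero =>
    refine ⟨M, hM, fun f _ hfM z hz => ⟨Polynomial.C (f (z 0)), by simp, fun k => ?_, ?_⟩⟩
    · rw [Polynomial.coeff_C]
      split_ifs
      · exact hfM _ (by simpa using hz 0)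
      · simpa using hM
    · intro j
      rw [Fin.fin_one_eq_zero j, Polynomial.eval_C]
  | succ n ih =>
    have hr : 0 < (2 * (n : ℝ) + 2) * η := by positivity
    -- Newton's scheme: the remaining nodes interpolate the divided difference `dslope f (z 0)`. The
    -- Schwarz lemma bounds it on the disc of radius `(2n+2)η` about `z 0`, which lies between the
    -- discs of radii `(2n+1)η` and `(2n+3)η` about `1`; each node costs `2η` of radius. In `M + 3 *
    -- B`, the `3` is `1 + 2`, from `X * p` and from `z 0 * p` with `‖z 0‖ ≤ 2`.
    obtain ⟨B, hB, H⟩ := ih ((2 * M + 1) / ((2 * n + 2) * η)) (by positivity)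
    refine ⟨M + 3 * B, by positivity, fun f hf hfM z hz => ?_⟩
    have hz0 : ‖z 0 - 1‖ < η := by simpa [dist_eq_norm] using hz 0
    have hsub : Metric.ball (z 0) ((2 * (n : ℝ) + 2) * η) ⊆
        Metric.ball 1 ((2 * ((n + 1 : ℕ) : ℝ) + 1) * η) := by
      apply Metric.ball_subset_ball'
      rw [dist_eq_norm]; push_cast; nlinarith
    have hsub2 : Metric.ball (1 : ℂ) ((2 * (n : ℝ) + 1) * η) ⊆
        Metric.ball (z 0) ((2 * (n : ℝ) + 2) * η) := by
      apply Metric.ball_subset_ball'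
      rw [dist_comm, dist_eq_norm]; nlinarith
    have hz0m : z 0 ∈ Metric.ball (z 0) ((2 * (n : ℝ) + 2) * η) := Metric.mem_ball_self hr
    have hfd := hf.mono hsub
    have hmaps : Set.MapsTo f (Metric.ball (z 0) ((2 * (n : ℝ) + 2) * η))
        (Metric.closedBall (f (z 0)) (2 * M + 1)) := by
      intro w hw
      rw [Metric.mem_closedBall, dist_eq_norm]
      have h1 := hfM w (hsub hw)
      have h2 := hfM _ (hsub hz0m)
      linarith [norm_sub_le (f w) (f (z 0))]
    obtain ⟨p, hp1, hp2, hp3⟩ := H (dslope f (z 0))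
      (((Complex.differentiableOn_dslope (Metric.isOpen_ball.mem_nhds hz0m)).2 hfd).mono hsub2)
      (fun w hw => Complex.norm_dslope_le_div_of_mapsTo_ball hfd hmaps (hsub2 hw))
      (fun j => z j.succ) (fun j => hz _)
    refine ⟨Polynomial.C (f (z 0)) + (Polynomial.X - Polynomial.C (z 0)) * p, ?_, ?_, ?_⟩
    · refine (Polynomial.natDegree_add_le _ _).trans (max_le (by simp) ?_)
      refine Polynomial.natDegree_mul_le.trans ?_
      rw [Polynomial.natDegree_X_sub_C]; omega
    · intro k
      have hz02 : ‖z 0‖ ≤ 2 := by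
        have := norm_add_le (z 0 - 1) 1
        rw [sub_add_cancel, norm_one] at this
        linarith
      have hf0 := hfM _ (hsub hz0m)
      have h1 : ‖(Polynomial.C (f (z 0))).coeff k‖ ≤ M := by
        rw [Polynomial.coeff_C]
        split_ifs
        · exact hf0
        · simpa using hM
      have h2 : ‖(Polynomial.X * p).coeff k‖ ≤ B := by
        cases k with
        | zero => simpa using hB
        | succ k => simpa using hp2 k
      have h3 : ‖(Polynomial.C (z 0) * p).coeff k‖ ≤ 2 * B := by
        rw [Polynomial.coeff_C_mul, norm_mul]
        exact mul_le_mul hz02 (hp2 k) (norm_nonneg _) (by norm_num)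
      rw [sub_mul, Polynomial.coeff_add, Polynomial.coeff_sub]
      linarith [norm_add_le ((Polynomial.C (f (z 0))).coeff k)
        ((Polynomial.X * p).coeff k - (Polynomial.C (z 0) * p).coeff k),
        norm_sub_le ((Polynomial.X * p).coeff k) ((Polynomial.C (z 0) * p).coeff k)]
    · intro j
      refine Fin.cases ?_ (fun j => ?_) j
      · simp
      · have := sub_smul_dslope f (z 0) (z j.succ)
        simp only [Polynomial.eval_add, Polynomial.eval_C, Polynomial.eval_mul,
          Polynomial.eval_sub, Polynomial.eval_X, hp3 j]
        rw [smul_eq_mul] at this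
        rw [this]; ring

/-- The identity function at `n + 1` nodes of the unit interval is a combination of `n + 1`
exponentials whose frequencies are in arithmetic progression, with coefficients bounded uniformly
in the nodes. -/
lemma exists_exponential_interpolation (n : ℕ) :
    ∃ η : ℝ, 0 < η ∧ ∀ m : ℕ, ∃ B : ℝ, 0 ≤ B ∧ ∀ h : ℝ, h ≠ 0 → |h| < η →
      ∀ τ : Fin (n + 1) → ℝ, (∀ j, 0 ≤ τ j ∧ τ j ≤ 1) →
      ∃ g : ℕ → ℂ, (∀ k, ‖g k‖ ≤ B / |h|) ∧
        ∀ j, (τ j : ℂ) = ∑ k ∈ Finset.range (n + 1),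
          g k * Complex.exp (Complex.I * ((h * (m + k) * τ j : ℝ) : ℂ)) := by
  -- This makes the disc of radius `(2n+1)η` equal to the one of radius `1/2` about `1`, inside the
  -- domain of the logarithm. `η` must not depend on `m`, since `m` is later taken large in terms of
  -- `η`; only `B` depends on `m`.
  set η : ℝ := 1 / (2 * (2 * n + 1)) with hηd
  have hη : 0 < η := by positivity
  have hη1 : η ≤ 1 := by
    rw [hηd, div_le_one (by positivity)]; linarith [(Nat.cast_nonneg n : (0 : ℝ) ≤ n)]
  have hrad : (2 * (n : ℝ) + 1) * η = 1 / 2 := by rw [hηd]; field_simp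
  refine ⟨η, hη, fun m => ?_⟩
  have hslit : Metric.closedBall (1 : ℂ) (1 / 2) ⊆ Complex.slitPlane := by
    intro z hz
    left
    rw [Metric.mem_closedBall, dist_eq_norm] at hz
    have := (Complex.abs_re_le_norm (z - 1)).trans hz
    rw [Complex.sub_re, Complex.one_re, abs_le] at this
    linarith [this.1]
  -- If `p` interpolates `log z / z ^ m` at `z j = exp (i h τ j)`, then multiplying by `z j ^ m`
  -- gives `i h τ j` as a combination of the powers `z j ^ (m + k)`. Division by `i h` yields the
  -- coefficients and their bound `B / |h|`.
  have hdiff : DifferentiableOn ℂ (fun z => Complex.log z / z ^ m)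
      (Metric.closedBall (1 : ℂ) (1 / 2)) := by
    intro z hz
    refine DifferentiableAt.differentiableWithinAt ?_
    have hz0 : z ≠ 0 := Complex.slitPlane_ne_zero (hslit hz)
    exact (Complex.differentiableAt_log (hslit hz)).div (by fun_prop) (pow_ne_zero _ hz0)
  obtain ⟨M, hM⟩ := (isCompact_closedBall (1 : ℂ) (1 / 2)).exists_bound_of_continuousOn
    hdiff.continuousOn
  have hM0 : 0 ≤ M := (norm_nonneg _).trans (hM 1 (by simp))
  obtain ⟨B, hB, H⟩ := exists_interpolating_polynomial n η hη hη1 M hM0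
  refine ⟨B, hB, fun h hh0 hh τ hτ => ?_⟩
  have hbound : ∀ j, |h * τ j| < η := fun j => by
    rw [abs_mul, abs_of_nonneg (hτ j).1]
    nlinarith [(hτ j).2, abs_nonneg h]
  obtain ⟨p, hp1, hp2, hp3⟩ := H (fun z => Complex.log z / z ^ m)
    (hdiff.mono (by rw [hrad]; exact Metric.ball_subset_closedBall))
    (fun z hz => hM z (by rw [hrad] at hz; exact Metric.ball_subset_closedBall hz))
    (fun j => Complex.exp (Complex.I * ((h * τ j : ℝ) : ℂ))) (fun j => by
      rw [Metric.mem_ball, dist_eq_norm]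
      refine lt_of_le_of_lt ?_ (hbound j)
      rw [← Real.norm_eq_abs]
      exact Real.norm_exp_I_mul_ofReal_sub_one_le)
  have hhI : Complex.I * (h : ℂ) ≠ 0 := by simp [hh0]
  refine ⟨fun k => p.coeff k / (Complex.I * h), fun k => ?_, fun j => ?_⟩
  · rw [norm_div, norm_mul, Complex.norm_I, one_mul, Complex.norm_real, Real.norm_eq_abs]
    exact div_le_div_of_nonneg_right (hp2 k) (abs_nonneg h)
  · have h3 := hp3 j
    have hpi : η < Real.pi := hη1.trans_lt (by linarith [Real.pi_gt_three])
    have hb := abs_lt.1 (hbound j)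
    rw [Complex.log_exp (by simpa using by linarith [hb.1]) (by simpa using by linarith [hb.2]),
      Polynomial.eval_eq_sum_range' (Nat.lt_succ_of_le hp1),
      eq_div_iff (pow_ne_zero _ (Complex.exp_ne_zero _)), Finset.sum_mul] at h3
    have h4 : (τ j : ℂ) = (Complex.I * ((h * τ j : ℝ) : ℂ)) / (Complex.I * h) := by
      push_cast; field_simp
    rw [h4, ← h3, Finset.sum_div]
    refine Finset.sum_congr rfl fun k _ => ?_
    rw [← Complex.exp_nat_mul, ← Complex.exp_nat_mul, mul_assoc, ← Complex.exp_add, div_mul_eq_mul_div]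
    congr 3
    push_cast; ring

end CollectiveDephasing

namespace CollectiveDephasing

/-! ## Low-frequency content of step functions is seen by every spectral profile -/

/-- A spectral profile is bounded below on a compact set of positive measure, away from `0`. -/
lemma IsSpectralProfile.exists_isCompact {σ : ℝ → ℝ} (hσ : IsSpectralProfile σ) :
    ∃ (F : Set ℝ) (δ R : ℝ), IsCompact F ∧ 0 < volume F ∧ 0 < δ ∧ δ ≤ R ∧
      ∀ x ∈ F, δ ≤ σ x ∧ δ ≤ |x| ∧ |x| ≤ R := by
  obtain ⟨σ', hm, hae⟩ := hσ.integrable.aestronglyMeasurable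
  set Z : Set ℝ := toMeasurable volume {x | ¬ σ x = σ' x}
  have hZ0 : volume Z = 0 := by rw [measure_toMeasurable]; exact hae
  have hZm : MeasurableSet Z := measurableSet_toMeasurable _ _
  have hsub : ∀ x, x ∉ Z → σ x = σ' x := fun x hx => by
    by_contra h
    exact hx (subset_toMeasurable _ _ h)
  -- Off the null sets `Z` and `{0}`, these sets exhaust the points where `σ` is nonzero, so one of
  -- them has positive measure. Inner regularity then gives the compact set.
  set A : ℕ → Set ℝ := fun n =>
    ({x | 1 / ((n : ℝ) + 1) ≤ σ' x} ∩ {x | 1 / ((n : ℝ) + 1) ≤ |x|} ∩ {x | |x| ≤ n + 1}) \ Z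
  have hA : ∀ n, MeasurableSet (A n) := fun n =>
    (((measurableSet_le measurable_const hm.measurable).inter
      (measurableSet_le measurable_const measurable_id.abs)).inter
      (measurableSet_le measurable_id.abs measurable_const)).diff hZm
  have hpos : ∃ n, volume (A n) ≠ 0 := by
    by_contra! hcon
    apply hσ.not_ae_zero
    have h1 : volume (⋃ n, A n) = 0 := measure_iUnion_null hcon
    have h2 : volume ((⋃ n, A n) ∪ Z ∪ {0}) = 0 := by
      rw [measure_union_null_iff, measure_union_null_iff]
      exact ⟨⟨h1, hZ0⟩, by simp⟩
    refine measure_mono_null (fun x hx => ?_) h2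
    by_contra hx'
    simp only [Set.mem_union, Set.mem_singleton_iff, not_or] at hx'
    obtain ⟨⟨hxA, hxZ⟩, hx0⟩ := hx'
    have hσ0 : 0 < σ' x := by
      rw [← hsub x hxZ]
      exact lt_of_le_of_ne (hσ.nonneg x) (Ne.symm hx)
    obtain ⟨n1, hn1⟩ := exists_nat_one_div_lt hσ0
    obtain ⟨n2, hn2⟩ := exists_nat_one_div_lt (abs_pos.2 hx0)
    obtain ⟨n3, hn3⟩ := exists_nat_ge |x|
    set n := max n1 (max n2 n3)
    have e1 : (n1 : ℝ) ≤ n := by exact_mod_cast le_max_left _ _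
    have e2 : (n2 : ℝ) ≤ n := by exact_mod_cast (le_max_left _ _).trans (le_max_right _ _)
    have e3 : (n3 : ℝ) ≤ n := by exact_mod_cast (le_max_right _ _).trans (le_max_right _ _)
    apply hxA
    refine Set.mem_iUnion.2 ⟨n, ⟨⟨?_, ?_⟩, ?_⟩, hxZ⟩
    · exact (one_div_le_one_div_of_le (by positivity) (by linarith)).trans hn1.le
    · exact (one_div_le_one_div_of_le (by positivity) (by linarith)).trans hn2.le
    · show |x| ≤ (n : ℝ) + 1
      linarith
  obtain ⟨n, hn⟩ := hpos
  obtain ⟨F, hFA, hF, hF0⟩ := (hA n).exists_lt_isCompact (pos_iff_ne_zero.2 hn)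
  refine ⟨F, 1 / ((n : ℝ) + 1), n + 1, hF, hF0, by positivity, ?_, fun x hx => ?_⟩
  · rw [div_le_iff₀ (by positivity)]
    nlinarith [(Nat.cast_nonneg n : (0 : ℝ) ≤ n)]
  · obtain ⟨⟨⟨h1, h2⟩, h3⟩, h4⟩ := hFA hx
    exact ⟨by rw [hsub x h4]; exact h1, h2, h3⟩

/-- A compact set of positive measure contains, for many of its points, finitely many slight
dilates of the point. -/
lemma eventually_pos_volume_dilates {F : Set ℝ} (hF : IsCompact F) (hF0 : 0 < volume F) (n : ℕ) :
    ∀ᶠ m : ℕ in Filter.atTop,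
      0 < volume {y ∈ F | ∀ k ∈ Finset.range (n + 1), (1 + (k : ℝ) / m) * y ∈ F} := by
  obtain ⟨R, hR⟩ := hF.isBounded.exists_norm_le
  have hFfin : volume F ≠ ⊤ := hF.measure_lt_top.ne
  have hrad : Filter.Tendsto (fun m : ℕ => (n : ℝ) * |R| / m) Filter.atTop (nhds 0) :=
    tendsto_const_div_atTop_nhds_zero_nat _
  have hthick := (tendsto_measure_cthickening_of_isCompact (μ := volume) hF).comp hrad
  -- Dilation by `1 + k / m` moves a point of `F` by at most `n |R| / m`, hence into a closed
  -- thickening whose measure tends to that of `F`. With the excess at most `|F| / (2 (n + 1))`, the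
  -- `n + 1` sets of points leaving `F` cover at most half of it.
  have hlt : volume F < volume F + volume F / (2 * (n + 1)) := by
    apply ENNReal.lt_add_right hFfin
    exact (ENNReal.div_pos hF0.ne' (by finiteness)).ne'
  filter_upwards [hthick.eventually_lt_const hlt, Filter.eventually_gt_atTop 0] with m hm hm0
  have hm0' : (0 : ℝ) < m := by exact_mod_cast hm0
  set C := Metric.cthickening ((n : ℝ) * |R| / m) F with hC
  have hCF : volume (C \ F) ≤ volume F / (2 * (n + 1)) := by
    rw [measure_sdiff (Metric.self_subset_cthickening _) hF.measurableSet.nullMeasurableSet hFfin]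
    exact tsub_le_iff_left.2 (by simpa [hC, Function.comp_def] using hm.le)
  have hbad : ∀ k ∈ Finset.range (n + 1),
      volume {y ∈ F | (1 + (k : ℝ) / m) * y ∉ F} ≤ volume F / (2 * (n + 1)) := by
    intro k hk
    have hlam : 1 ≤ 1 + (k : ℝ) / m := le_add_of_nonneg_right (by positivity)
    refine le_trans (measure_mono (t := (fun y => (1 + (k : ℝ) / m) * y) ⁻¹' (C \ F)) ?_) ?_
    · rintro y ⟨hy, hy'⟩
      refine ⟨Metric.mem_cthickening_of_dist_le _ y _ _ hy ?_, hy'⟩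
      have hk' : (k : ℝ) ≤ n := by exact_mod_cast Nat.lt_succ_iff.1 (Finset.mem_range.1 hk)
      have hyR : |y| ≤ |R| := (hR y hy).trans (le_abs_self R)
      rw [Real.dist_eq]
      have : (1 + (k : ℝ) / m) * y - y = k / m * y := by ring
      rw [this, abs_mul, abs_of_nonneg (by positivity : (0 : ℝ) ≤ (k : ℝ) / m), div_mul_eq_mul_div]
      gcongr
    · rw [Real.volume_preimage_mul_left (by linarith)]
      refine le_trans ?_ hCF
      conv_rhs => rw [← one_mul (volume (C \ F))]
      gcongr
      rw [ENNReal.ofReal_le_one, abs_of_nonneg (by positivity)]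
      exact inv_le_one_of_one_le₀ hlam
  by_contra hcon
  have hcon' := nonpos_iff_eq_zero.1 (not_lt.1 hcon)
  have hcover : F ⊆ {y ∈ F | ∀ k ∈ Finset.range (n + 1), (1 + (k : ℝ) / m) * y ∈ F} ∪
      ⋃ k ∈ Finset.range (n + 1), {y ∈ F | (1 + (k : ℝ) / m) * y ∉ F} := by
    intro y hy
    by_cases h : ∀ k ∈ Finset.range (n + 1), (1 + (k : ℝ) / m) * y ∈ F
    · exact Or.inl ⟨hy, h⟩
    · push Not at h
      obtain ⟨k, hk, hk'⟩ := h
      exact Or.inr (Set.mem_biUnion hk ⟨hy, hk'⟩)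
  have h1 : volume F ≤ 0 + ∑ k ∈ Finset.range (n + 1), volume F / (2 * (n + 1)) := by
    refine (measure_mono hcover).trans ((measure_union_le _ _).trans ?_)
    rw [hcon']
    gcongr
    exact (measure_biUnion_finset_le _ _).trans (Finset.sum_le_sum hbad)
  rw [zero_add, Finset.sum_const, Finset.card_range, nsmul_eq_mul] at h1
  have h2 : ((n + 1 : ℕ) : ENNReal) * (volume F / (2 * (n + 1))) = volume F / 2 := by
    rw [ENNReal.div_eq_inv_mul, ENNReal.mul_inv (by simp) (by simp), ENNReal.div_eq_inv_mul]
    push_cast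
    rw [mul_comm (2⁻¹ : ENNReal), ← mul_assoc, ← mul_assoc, ENNReal.mul_inv_cancel (by simp) (by finiteness),
      one_mul]
  rw [h2] at h1
  exact absurd h1 (not_le.2 (ENNReal.half_lt_self hF0.ne' hFfin))

/-- The Fourier transform of the step function with value `w j` on the `j`-th cell of the
partition `τ`. -/
noncomputable def stepTransform {n : ℕ} (τ : Fin (n + 1) → ℝ) (w : Fin n → ℝ) (y : ℝ) : ℂ :=
  ∑ j, (w j : ℂ) * ∫ s in (τ j.castSucc)..(τ j.succ), Complex.exp (Complex.I * ((y * s : ℝ) : ℂ))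

lemma continuous_stepTransform {n : ℕ} (τ : Fin (n + 1) → ℝ) (w : Fin n → ℝ) :
    Continuous (stepTransform τ w) := by
  refine continuous_finsetSum _ fun j _ => continuous_const.mul ?_
  exact intervalIntegral.continuous_parametric_intervalIntegral_of_continuous'
    (f := fun y s => Complex.exp (Complex.I * ((y * s : ℝ) : ℂ)))
    (by unfold Function.uncurry; fun_prop) _ _

lemma norm_stepTransform_le {n : ℕ} (τ : Fin (n + 1) → ℝ) (w : Fin n → ℝ) (y : ℝ) :
    ‖stepTransform τ w y‖ ≤ ∑ j, |w j| * |τ j.succ - τ j.castSucc| := by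
  refine (norm_sum_le _ _).trans (Finset.sum_le_sum fun j _ => ?_)
  rw [norm_mul, Complex.norm_real, Real.norm_eq_abs]
  gcongr
  have := intervalIntegral.norm_integral_le_of_norm_le_const (a := τ j.castSucc) (b := τ j.succ)
    (f := fun s => Complex.exp (Complex.I * ((y * s : ℝ) : ℂ))) (C := 1)
    (fun s _ => by rw [mul_comm, Complex.norm_exp_ofReal_mul_I])
  simpa using this

lemma integrable_mul_normSq_stepTransform {f : ℝ → ℝ} (hf : Integrable f) {n : ℕ}
    (τ : Fin (n + 1) → ℝ) (w : Fin n → ℝ) (a : ℝ) :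
    Integrable (fun y => f y * ‖stepTransform τ w (a * y)‖ ^ 2) := by
  refine hf.mul_bdd (c := (∑ j, |w j| * |τ j.succ - τ j.castSucc|) ^ 2) ?_ ?_
  · exact (((continuous_stepTransform τ w).comp (by fun_prop)).norm.pow 2).aestronglyMeasurable
  · refine Filter.Eventually.of_forall fun y => ?_
    rw [Real.norm_eq_abs, abs_of_nonneg (by positivity)]
    gcongr
    exact norm_stepTransform_le _ _ _

/-- If the identity is interpolated at the partition points by exponentials, then the mean of a
step function is the corresponding combination of values of its Fourier transform. -/
lemma sum_mul_eq_of_interpolation {n : ℕ} (τ : Fin (n + 1) → ℝ) (w : Fin n → ℝ) (s : Finset ℕ)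
    (g : ℕ → ℂ) (y : ℕ → ℝ)
    (h : ∀ j, (τ j : ℂ) = ∑ k ∈ s, g k * Complex.exp (Complex.I * ((y k * τ j : ℝ) : ℂ))) :
    ((∑ j, w j * (τ j.succ - τ j.castSucc) : ℝ) : ℂ) =
      ∑ k ∈ s, g k * (Complex.I * y k) * stepTransform τ w (y k) := by
  -- Cell lengths are increments of the identity, hence combinations of increments of exponentials.
  -- Each of those is `i y` times an integral occurring in the transform.
  have hint : ∀ (k : ℕ) (a b : ℝ), (Complex.I * y k) *
      ∫ u in a..b, Complex.exp (Complex.I * ((y k * u : ℝ) : ℂ)) =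
      Complex.exp (Complex.I * ((y k * b : ℝ) : ℂ)) -
        Complex.exp (Complex.I * ((y k * a : ℝ) : ℂ)) := by
    intro k a b
    by_cases hy : y k = 0
    · simp [hy]
    · have hc : Complex.I * (y k : ℂ) ≠ 0 := by simp [hy]
      have := integral_exp_mul_complex (a := a) (b := b) hc
      simp only [Complex.ofReal_mul, ← mul_assoc]
      rw [this]; field_simp
  simp only [stepTransform, Finset.mul_sum]
  rw [Finset.sum_comm]
  rw [Complex.ofReal_sum]
  refine Finset.sum_congr rfl fun j _ => ?_
  rw [Complex.ofReal_mul, Complex.ofReal_sub, h j.succ, h j.castSucc, ← Finset.sum_sub_distrib, Finset.mul_sum]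
  refine Finset.sum_congr rfl fun k _ => ?_
  rw [← mul_sub, ← hint]; ring

/-- For every spectral profile `σ` the mean of a step function with `n` steps on the unit interval
is controlled by its energy weighted with `σ`, uniformly in the partition. -/
lemma IsSpectralProfile.exists_mean_sq_le {σ : ℝ → ℝ} (hσ : IsSpectralProfile σ) (n : ℕ) :
    ∃ K : ℝ, 0 < K ∧ ∀ τ : Fin (n + 1) → ℝ, (∀ j, 0 ≤ τ j ∧ τ j ≤ 1) → ∀ w : Fin n → ℝ,
      (∑ j, w j * (τ j.succ - τ j.castSucc)) ^ 2 ≤ K * ∫ y, σ y * ‖stepTransform τ w y‖ ^ 2 := by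
  obtain ⟨F, δ, R, hF, hF0, hδ, hδR, hFb⟩ := hσ.exists_isCompact
  obtain ⟨η, hη, Hη⟩ := exists_exponential_interpolation n
  have hev : ∀ᶠ m : ℕ in Filter.atTop, R / m < η :=
    (tendsto_const_div_atTop_nhds_zero_nat R).eventually_lt_const hη
  -- `m` depends on `σ` and `n` only. It makes the dilates stay in `F` on a set of positive measure,
  -- and makes `h = y / m` admissible for the interpolation whenever `|y| ≤ R`.
  obtain ⟨m, ⟨hmE, hmη⟩, hm0⟩ := (((eventually_pos_volume_dilates hF hF0 n).and hev).and
    (Filter.eventually_gt_atTop 0)).exists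
  have hm0' : (0 : ℝ) < m := by exact_mod_cast hm0
  obtain ⟨B, hB, HB⟩ := Hη m
  set E : Set ℝ := {y ∈ F | ∀ k ∈ Finset.range (n + 1), (1 + (k : ℝ) / m) * y ∈ F} with hE
  have hEm : MeasurableSet E := by
    have : E = F ∩ ⋂ k ∈ Finset.range (n + 1), (fun y : ℝ => (1 + (k : ℝ) / m) * y) ⁻¹' F := by
      ext y; simp [hE]
    rw [this]
    refine hF.measurableSet.inter (Finset.measurableSet_biInter _ fun k _ => ?_)
    exact hF.measurableSet.preimage (by fun_prop)
  have hEtop : volume E ≠ ⊤ := ((measure_mono (Set.sep_subset _ _)).trans_lt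
    hF.measure_lt_top).ne
  have hEpos : 0 < volume.real E := ENNReal.toReal_pos hmE.ne' hEtop
  -- This bounds `|g k| |y k|`: the coefficient is at most `B / |h| = B m / |y| ≤ B m / δ`, and the
  -- dilated frequency, lying in `F`, is at most `R`.
  set D : ℝ := B * m / δ * R with hD
  have hD0 : 0 ≤ D := by have := hδ.le.trans hδR; positivity
  -- One `n + 1` comes from Cauchy–Schwarz and the other counts the dilates, each contributing at
  -- most the energy divided by `δ`. The `+ 1` keeps the constant positive even if `D = 0`.
  refine ⟨((n + 1 : ℕ) * D ^ 2 * ((n + 1 : ℕ) / δ)) / volume.real E + 1, by positivity,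
    fun τ hτ w => ?_⟩
  set V := stepTransform τ w with hV
  set L := ∑ j, w j * (τ j.succ - τ j.castSucc) with hL
  have hpt : ∀ y ∈ E, L ^ 2 ≤ (n + 1 : ℕ) * D ^ 2 *
      ∑ k ∈ Finset.range (n + 1), ‖V ((1 + (k : ℝ) / m) * y)‖ ^ 2 := by
    rintro y ⟨hyF, hy⟩
    obtain ⟨-, hy1, hy2⟩ := hFb y hyF
    have hy0 : y ≠ 0 := by
      rintro rfl
      rw [abs_zero] at hy1; linarith
    obtain ⟨g, hg1, hg2⟩ := HB (y / m) (div_ne_zero hy0 hm0'.ne') (by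
      rw [abs_div, abs_of_pos hm0']
      exact (div_le_div_of_nonneg_right hy2 hm0'.le).trans_lt hmη) τ hτ
    have hyk : ∀ k : ℕ, y / m * (m + k) = (1 + (k : ℝ) / m) * y := fun k => by field_simp
    simp only [hyk] at hg2
    have hmain := sum_mul_eq_of_interpolation τ w (Finset.range (n + 1)) g
      (fun k => (1 + (k : ℝ) / m) * y) hg2
    have habs : |L| ≤ ∑ k ∈ Finset.range (n + 1), D * ‖V ((1 + (k : ℝ) / m) * y)‖ := by
      rw [← Real.norm_eq_abs, ← Complex.norm_real, hL, hmain]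
      refine (norm_sum_le _ _).trans (Finset.sum_le_sum fun k hk => ?_)
      rw [norm_mul, norm_mul, norm_mul, Complex.norm_I, one_mul, Complex.norm_real,
        Real.norm_eq_abs]
      refine mul_le_mul_of_nonneg_right ?_ (norm_nonneg _)
      refine mul_le_mul ?_ (hFb _ (hy k hk)).2.2 (abs_nonneg _) (by positivity)
      refine (hg1 k).trans ?_
      rw [abs_div, abs_of_pos hm0', div_div_eq_mul_div]
      gcongr
    rw [← Finset.mul_sum] at habs
    calc L ^ 2 = |L| ^ 2 := (sq_abs L).symm
      _ ≤ (D * ∑ k ∈ Finset.range (n + 1), ‖V ((1 + (k : ℝ) / m) * y)‖) ^ 2 := by gcongr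
      _ = D ^ 2 * (∑ k ∈ Finset.range (n + 1), ‖V ((1 + (k : ℝ) / m) * y)‖) ^ 2 := by ring
      _ ≤ D ^ 2 * ((n + 1 : ℕ) *
            ∑ k ∈ Finset.range (n + 1), ‖V ((1 + (k : ℝ) / m) * y)‖ ^ 2) := by
          gcongr
          simpa using sq_sum_le_card_mul_sum_sq (s := Finset.range (n + 1))
            (f := fun k : ℕ => ‖V ((1 + (k : ℝ) / m) * y)‖)
      _ = _ := by ring
  set I := ∫ y, σ y * ‖V y‖ ^ 2 with hI
  have hVc : Continuous V := continuous_stepTransform τ w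
  have hIint : Integrable (fun y => σ y * ‖V y‖ ^ 2) := by
    simpa using integrable_mul_normSq_stepTransform hσ.integrable τ w 1
  have hI0 : 0 ≤ I := integral_nonneg fun y => mul_nonneg (hσ.nonneg y) (by positivity)
  have hFI : ∫ y in F, ‖V y‖ ^ 2 ≤ I / δ := by
    rw [le_div_iff₀ hδ, mul_comm, ← integral_const_mul]
    refine (setIntegral_mono_on ?_ hIint.integrableOn hF.measurableSet fun y hy => ?_).trans
      (setIntegral_le_integral hIint
        (Filter.Eventually.of_forall fun y => mul_nonneg (hσ.nonneg y) (by positivity)))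
    · exact (continuous_const.mul (hVc.norm.pow 2)).continuousOn.integrableOn_compact hF
    · exact mul_le_mul_of_nonneg_right (hFb y hy).1 (by positivity)
  have hkI : ∀ k ∈ Finset.range (n + 1),
      ∫ y in E, ‖V ((1 + (k : ℝ) / m) * y)‖ ^ 2 ≤ I / δ := by
    intro k hk
    have hlam : 1 ≤ 1 + (k : ℝ) / m := le_add_of_nonneg_right (by positivity)
    refine le_trans ?_ hFI
    rw [← integral_indicator hEm, ← integral_indicator hF.measurableSet]
    have hFint : Integrable (F.indicator fun y => ‖V y‖ ^ 2) :=
      (integrable_indicator_iff hF.measurableSet).2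
        ((hVc.norm.pow 2).continuousOn.integrableOn_compact hF)
    have hnn : ∀ y, 0 ≤ F.indicator (fun y => ‖V y‖ ^ 2) y :=
      fun y => Set.indicator_nonneg (fun _ _ => by positivity) y
    calc ∫ y, E.indicator (fun y => ‖V ((1 + (k : ℝ) / m) * y)‖ ^ 2) y
        ≤ ∫ y, F.indicator (fun y => ‖V y‖ ^ 2) ((1 + (k : ℝ) / m) * y) := by
          refine integral_mono_of_nonneg (Filter.Eventually.of_forall fun y =>
            Set.indicator_nonneg (fun _ _ => by positivity) y)
            (hFint.comp_mul_left' (by linarith)) (Filter.Eventually.of_forall fun y => ?_)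
          show E.indicator (fun y => ‖V ((1 + (k : ℝ) / m) * y)‖ ^ 2) y ≤
            F.indicator (fun y => ‖V y‖ ^ 2) ((1 + (k : ℝ) / m) * y)
          by_cases hy : y ∈ E
          · rw [Set.indicator_of_mem hy, Set.indicator_of_mem (hy.2 k hk)]
          · rw [Set.indicator_of_notMem hy]; exact hnn _
      _ = |(1 + (k : ℝ) / m)⁻¹| * ∫ y, F.indicator (fun y => ‖V y‖ ^ 2) y := by
          rw [Measure.integral_comp_mul_left, smul_eq_mul]
      _ ≤ 1 * ∫ y, F.indicator (fun y => ‖V y‖ ^ 2) y := by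
          refine mul_le_mul_of_nonneg_right ?_ (integral_nonneg hnn)
          rw [abs_of_nonneg (by positivity)]
          exact inv_le_one_of_one_le₀ hlam
      _ = _ := one_mul _
  have hEint : ∀ k ∈ Finset.range (n + 1),
      IntegrableOn (fun y => ‖V ((1 + (k : ℝ) / m) * y)‖ ^ 2) E := fun k _ =>
    ((Continuous.continuousOn (by fun_prop)).integrableOn_compact hF).mono_set (Set.sep_subset _ _)
  have hfin : L ^ 2 * volume.real E ≤ (n + 1 : ℕ) * D ^ 2 * ((n + 1 : ℕ) * (I / δ)) := by
    calc L ^ 2 * volume.real E = ∫ y in E, L ^ 2 := by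
          rw [setIntegral_const, smul_eq_mul, mul_comm]
      _ ≤ ∫ y in E, (n + 1 : ℕ) * D ^ 2 *
            ∑ k ∈ Finset.range (n + 1), ‖V ((1 + (k : ℝ) / m) * y)‖ ^ 2 := by
          refine setIntegral_mono_on (integrableOn_const hEtop) ?_ hEm hpt
          exact (integrable_finsetSum _ hEint).const_mul _
      _ = (n + 1 : ℕ) * D ^ 2 *
            ∑ k ∈ Finset.range (n + 1), ∫ y in E, ‖V ((1 + (k : ℝ) / m) * y)‖ ^ 2 := by
          rw [integral_const_mul, integral_finsetSum _ hEint]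
      _ ≤ (n + 1 : ℕ) * D ^ 2 * ((n + 1 : ℕ) * (I / δ)) := by
          gcongr
          simpa using Finset.sum_le_card_nsmul (Finset.range (n + 1)) _ _ hkI
  rw [add_mul, one_mul]
  refine le_trans ?_ (le_add_of_nonneg_right hI0)
  rw [div_mul_eq_mul_div, le_div_iff₀ hEpos]
  refine hfin.trans (le_of_eq ?_)
  ring

end CollectiveDephasing

namespace CollectiveDephasing

/-! ## Time integrals of stationary Gaussian noise -/

lemma integrable_mul_cos {S : ℝ → ℝ} (hS : Integrable S) (u : ℝ) :
    Integrable fun w => S w * Real.cos (w * u) := by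
  refine hS.mul_bdd (c := 1) (by fun_prop) (Filter.Eventually.of_forall fun w => ?_)
  rw [Real.norm_eq_abs]; exact Real.abs_cos_le_one _

lemma continuous_correlation {S : ℝ → ℝ} (hS : Integrable S) : Continuous (correlation S) := by
  refine continuous_const.mul ?_
  refine continuous_of_dominated (bound := fun w => ‖S w‖) ?_ ?_ hS.norm ?_
  · exact fun u => (integrable_mul_cos hS u).aestronglyMeasurable
  · refine fun u => Filter.Eventually.of_forall fun w => ?_
    rw [norm_mul]
    exact mul_le_of_le_one_right (norm_nonneg _) (by
      rw [Real.norm_eq_abs]; exact Real.abs_cos_le_one _)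
  · exact Filter.Eventually.of_forall fun w => by fun_prop

lemma normSq_sum_mul_exp {ι : Type*} [Fintype ι] (a s : ι → ℝ) (w : ℝ) :
    ‖∑ i, (a i : ℂ) * Complex.exp (Complex.I * ((w * s i : ℝ) : ℂ))‖ ^ 2 =
      ∑ i, ∑ k, a i * a k * Real.cos (w * (s i - s k)) := by
  have hz : ∑ i, (a i : ℂ) * Complex.exp (Complex.I * ((w * s i : ℝ) : ℂ)) =
      ((∑ i, a i * Real.cos (w * s i) : ℝ) : ℂ) +
        ((∑ i, a i * Real.sin (w * s i) : ℝ) : ℂ) * Complex.I := by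
    rw [Complex.ofReal_sum, Complex.ofReal_sum, Finset.sum_mul, ← Finset.sum_add_distrib]
    refine Finset.sum_congr rfl fun i _ => ?_
    rw [mul_comm Complex.I, Complex.exp_mul_I, ← Complex.ofReal_cos, ← Complex.ofReal_sin,
      Complex.ofReal_mul, Complex.ofReal_mul]
    ring
  rw [hz, ← Complex.normSq_eq_norm_sq, Complex.normSq_add_mul_I, sq, sq, Finset.sum_mul_sum,
    Finset.sum_mul_sum, ← Finset.sum_add_distrib]
  refine Finset.sum_congr rfl fun i _ => ?_
  rw [← Finset.sum_add_distrib]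
  refine Finset.sum_congr rfl fun k _ => ?_
  rw [mul_sub, Real.cos_sub]; ring

/-- A Riemann sum with `n` equal cells differs from the integral by at most the integral of the
oscillation over the cells. -/
lemma norm_riemannSum_sub_integral_le {E : Type*} [NormedAddCommGroup E] [NormedSpace ℝ E]
    [CompleteSpace E] {f : ℝ → E} {a b : ℝ} (hab : a ≤ b) (hf : IntervalIntegrable f volume a b)
    {n : ℕ} (hn : 0 < n) :
    ‖∑ k : Fin n, ((b - a) / n) • f (a + k * ((b - a) / n)) - ∫ s in a..b, f s‖ ≤
      ∑ k : Fin n, ∫ s in (a + k * ((b - a) / n))..(a + (k + 1) * ((b - a) / n)),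
        ‖f (a + k * ((b - a) / n)) - f s‖ := by
  have hn' : (0 : ℝ) < n := by exact_mod_cast hn
  set d := (b - a) / n with hd
  have hd0 : 0 ≤ d := div_nonneg (sub_nonneg.2 hab) hn'.le
  have hnd : n * d = b - a := by rw [hd]; field_simp
  have hcell : ∀ k < n, IntervalIntegrable f volume (a + k * d) (a + ((k + 1 : ℕ) : ℝ) * d) := by
    intro k hk
    have hk' : ((k : ℝ) + 1) ≤ n := by exact_mod_cast hk
    refine hf.mono_set ?_
    rw [Set.uIcc_of_le hab, Set.uIcc_of_le (by push_cast; nlinarith)]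
    refine Set.Icc_subset_Icc ?_ ?_
    · nlinarith [mul_nonneg (Nat.cast_nonneg k : (0 : ℝ) ≤ k) hd0]
    · push_cast; nlinarith
  have hsum : ∫ s in a..b, f s =
      ∑ k : Fin n, ∫ s in (a + k * d)..(a + (k + 1) * d), f s := by
    have := intervalIntegral.sum_integral_adjacent_intervals (μ := volume)
      (a := fun k : ℕ => a + k * d) (n := n) hcell
    rw [Finset.sum_range] at this
    push_cast at this
    rw [this, hnd]; simp
  rw [hsum, ← Finset.sum_sub_distrib]
  refine (norm_sum_le _ _).trans (Finset.sum_le_sum fun k _ => ?_)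
  have hk := hcell k k.2
  push_cast at hk
  have hle : a + k * d ≤ a + (k + 1) * d := by nlinarith
  have hconst : d • f (a + k * d) = ∫ s in (a + k * d)..(a + (k + 1) * d), f (a + k * d) := by
    rw [intervalIntegral.integral_const]; congr 1; ring
  rw [hconst, ← intervalIntegral.integral_sub (by simp) hk]
  exact intervalIntegral.norm_integral_le_integral_norm hle

section Noise

variable {Ω : Type*} [MeasurableSpace Ω] {P : Measure Ω} {ξ : ℝ → Ω → ℝ} {S : ℝ → ℝ}

lemma IsStationaryGaussianNoise.memLp (h : IsStationaryGaussianNoise P ξ S) (s : ℝ) :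
    MemLp (ξ s) 2 P := (h.gaussian.hasGaussianLaw_eval s).memLp_two

lemma IsStationaryGaussianNoise.measurable_integral (h : IsStationaryGaussianNoise P ξ S)
    {a b : ℝ} (hab : a ≤ b) : Measurable (fun x => ∫ s in a..b, ξ s x) := by
  simp only [intervalIntegral.integral_of_le hab]
  exact (h.measurable.stronglyMeasurable.integral_prod_left'
    (μ := volume.restrict (Set.Ioc a b))).measurable

variable [IsProbabilityMeasure P]

/-- The variance of `|ξ s - ξ s'|` is nonnegative, and stationarity evaluates the second moment.
Since the correlation is continuous, the noise is continuous in mean, uniformly in time, which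
drives the Riemann sums below. -/
lemma IsStationaryGaussianNoise.integral_abs_sub_le (h : IsStationaryGaussianNoise P ξ S)
    (s s' : ℝ) :
    ∫ x, |ξ s x - ξ s' x| ∂P ≤ Real.sqrt (2 * (correlation S 0 - correlation S (s - s'))) := by
  have hL := (h.memLp s).sub (h.memLp s')
  have hcs : (∫ x, |ξ s x - ξ s' x| ∂P) ^ 2 ≤ ∫ x, (ξ s x - ξ s' x) ^ 2 ∂P := by
    have hv := variance_nonneg (fun x => |ξ s x - ξ s' x|) P
    rw [variance_eq_sub (by simpa using hL.norm)] at hv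
    simp only [Pi.pow_apply, sq_abs] at hv
    linarith
  have hcomp : ∫ x, (ξ s x - ξ s' x) ^ 2 ∂P = 2 * (correlation S 0 - correlation S (s - s')) := by
    have e : ∀ x, (ξ s x - ξ s' x) ^ 2 = ξ s x * ξ s x + ξ s' x * ξ s' x -
        2 * (ξ s x * ξ s' x) := fun x => by ring
    have i1 := (h.memLp s).integrable_mul (h.memLp s)
    have i2 := (h.memLp s').integrable_mul (h.memLp s')
    have i3 := (h.memLp s).integrable_mul (h.memLp s')
    simp only [Pi.mul_def] at i1 i2 i3
    simp_rw [e]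
    rw [integral_sub (by exact i1.add i2) (i3.const_mul 2), integral_add i1 i2, integral_const_mul,
      h.covariance, h.covariance, h.covariance, sub_self, sub_self]
    ring
  rw [← hcomp]
  exact Real.le_sqrt_of_sq_le hcs

/-- Every finite linear combination of noise values is a centred Gaussian variable, with variance
given by the spectrum. -/
lemma IsStationaryGaussianNoise.integral_exp_sum (h : IsStationaryGaussianNoise P ξ S)
    (hS : Integrable S) {ι : Type*} [Fintype ι] (a s : ι → ℝ) :
    ∫ x, Complex.exp (Complex.I * ((∑ i, a i * ξ (s i) x : ℝ) : ℂ)) ∂P =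
      Complex.exp (-(((2 * Real.pi)⁻¹ * ∫ w, S w *
        ‖∑ i, (a i : ℂ) * Complex.exp (Complex.I * ((w * s i : ℝ) : ℂ))‖ ^ 2 : ℝ) : ℂ) / 2) := by
  have hG : HasGaussianLaw (fun x => ∑ i, a i * ξ (s i) x) P := by
    have := ((h.gaussian.comp_right s).smul a).hasGaussianLaw_fun_sum (I := Finset.univ)
    simpa using this
  have hint : ∀ i, Integrable (ξ (s i)) P := fun i => (h.memLp _).integrable (by norm_num)
  have hmean : ∫ x, ∑ i, a i * ξ (s i) x ∂P = 0 := by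
    rw [integral_finsetSum _ fun i _ => (hint i).const_mul _]
    simp [integral_const_mul, h.mean_zero]
  have hvar : Var[fun x => ∑ i, a i * ξ (s i) x; P] = (2 * Real.pi)⁻¹ * ∫ w, S w *
        ‖∑ i, (a i : ℂ) * Complex.exp (Complex.I * ((w * s i : ℝ) : ℂ))‖ ^ 2 := by
    rw [variance_of_integral_eq_zero hG.aemeasurable hmean]
    have e : ∀ x, (∑ i, a i * ξ (s i) x) ^ 2 =
        ∑ i, ∑ k, a i * a k * (ξ (s i) x * ξ (s k) x) := fun x => by
      rw [sq, Finset.sum_mul_sum]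
      exact Finset.sum_congr rfl fun i _ => Finset.sum_congr rfl fun k _ => by ring
    have i1 : ∀ i k, Integrable (fun x => a i * a k * (ξ (s i) x * ξ (s k) x)) P := fun i k =>
      ((h.memLp (s i)).integrable_mul (h.memLp (s k))).const_mul _
    have i2 : ∀ i k, Integrable (fun w => a i * a k * (S w * Real.cos (w * (s i - s k)))) :=
      fun i k => (integrable_mul_cos hS _).const_mul _
    have e2 : ∀ w, S w * ‖∑ i, (a i : ℂ) * Complex.exp (Complex.I * ((w * s i : ℝ) : ℂ))‖ ^ 2 =
        ∑ i, ∑ k, a i * a k * (S w * Real.cos (w * (s i - s k))) := fun w => by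
      rw [normSq_sum_mul_exp, Finset.mul_sum]
      refine Finset.sum_congr rfl fun i _ => ?_
      rw [Finset.mul_sum]
      exact Finset.sum_congr rfl fun k _ => by ring
    simp only [e, e2]
    rw [integral_finsetSum _ fun i _ => integrable_finsetSum _ fun k _ => i1 i k,
      integral_finsetSum _ fun i _ => integrable_finsetSum _ fun k _ => i2 i k, Finset.mul_sum]
    refine Finset.sum_congr rfl fun i _ => ?_
    rw [integral_finsetSum _ fun k _ => i1 i k, integral_finsetSum _ fun k _ => i2 i k,
      Finset.mul_sum]
    refine Finset.sum_congr rfl fun k _ => ?_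
    rw [integral_const_mul, integral_const_mul, h.covariance, correlation]
    ring
  have hlaw := hG.map_eq_gaussianReal
  rw [hmean, hvar] at hlaw
  have hcf := charFun_gaussianReal (μ := 0) (v := Real.toNNReal ((2 * Real.pi)⁻¹ * ∫ w, S w *
        ‖∑ i, (a i : ℂ) * Complex.exp (Complex.I * ((w * s i : ℝ) : ℂ))‖ ^ 2)) 1
  rw [← hlaw, charFun_apply_real, integral_map hG.aemeasurable (by fun_prop)] at hcf
  rw [← hvar] at hcf ⊢
  rw [Real.coe_toNNReal _ (variance_nonneg _ _)] at hcf
  simp only [Complex.ofReal_one, one_mul, Complex.ofReal_zero, mul_zero, zero_mul, zero_sub,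
    one_pow, mul_one] at hcf
  rw [neg_div, ← hcf]
  simp only [mul_comm Complex.I]

lemma IsStationaryGaussianNoise.integral_abs_le (h : IsStationaryGaussianNoise P ξ S) (s : ℝ) :
    ∫ x, |ξ s x| ∂P ≤ 1 + correlation S 0 := by
  have hL := h.memLp s
  have h2 := h.covariance s s
  rw [sub_self] at h2
  rw [← h2]
  have hi := hL.integrable_mul hL
  simp only [Pi.mul_def] at hi
  have : (1 : ℝ) + ∫ x, ξ s x * ξ s x ∂P = ∫ x, (1 + ξ s x * ξ s x) ∂P := by
    rw [integral_add (integrable_const _) hi]; simp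
  rw [this]
  refine integral_mono (hL.integrable (by norm_num)).abs ((integrable_const _).add hi) fun x => ?_
  show |ξ s x| ≤ 1 + ξ s x * ξ s x
  nlinarith [sq_abs (ξ s x), sq_nonneg (|ξ s x| - 1), abs_nonneg (ξ s x)]

/-- By stationarity the first moments are bounded uniformly in time. Fubini's theorem then makes
almost every path integrable on a bounded interval, although no continuity of paths is assumed. -/
lemma IsStationaryGaussianNoise.integrable_prod (h : IsStationaryGaussianNoise P ξ S) (a b : ℝ) :
    Integrable (Function.uncurry ξ) ((volume.restrict (Set.Ioc a b)).prod P) := by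
  rw [integrable_prod_iff h.measurable.aestronglyMeasurable]
  refine ⟨Filter.Eventually.of_forall fun s => (h.memLp s).integrable (by norm_num), ?_⟩
  refine Integrable.of_bound (C := 1 + correlation S 0) ?_ (Filter.Eventually.of_forall fun s => ?_)
  · exact (h.measurable.norm.stronglyMeasurable.integral_prod_right').aestronglyMeasurable
  · rw [Real.norm_eq_abs, abs_of_nonneg (integral_nonneg fun x => norm_nonneg _)]
    exact h.integral_abs_le s

lemma IsStationaryGaussianNoise.ae_intervalIntegrable (h : IsStationaryGaussianNoise P ξ S)
    {a b : ℝ} (hab : a ≤ b) :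
    ∀ᵐ x ∂P, IntervalIntegrable (fun s => ξ s x) volume a b := by
  filter_upwards [(h.integrable_prod a b).prod_left_ae] with x hx
  rw [intervalIntegrable_iff_integrableOn_Ioc_of_le hab]
  exact hx

lemma IsStationaryGaussianNoise.integrable_integral (h : IsStationaryGaussianNoise P ξ S)
    {a b : ℝ} (hab : a ≤ b) : Integrable (fun x => ∫ s in a..b, ξ s x) P := by
  simp only [intervalIntegral.integral_of_le hab]
  exact (h.integrable_prod a b).integral_prod_right

/-- The Riemann sums of the noise converge to its integral in mean. -/
lemma IsStationaryGaussianNoise.tendsto_riemannSum (h : IsStationaryGaussianNoise P ξ S)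
    (hS : Integrable S) {a b : ℝ} (hab : a ≤ b) :
    Filter.Tendsto (fun n : ℕ => ∫ x, |∑ k : Fin n, (b - a) / n * ξ (a + k * ((b - a) / n)) x -
      ∫ s in a..b, ξ s x| ∂P) Filter.atTop (nhds 0) := by
  rw [Metric.tendsto_nhds]
  intro ε hε
  set G : ℝ → ℝ := fun u => Real.sqrt (2 * (correlation S 0 - correlation S u)) with hG
  have hGc : Continuous G := by
    have := continuous_correlation hS
    fun_prop
  have hG0 : G 0 = 0 := by simp [hG]
  -- The errors of the cells add up to `ε (b - a) / (2 (b - a + 1)) < ε`; the `+ 1` covers `a = b`.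
  obtain ⟨r, hr, hr'⟩ := Metric.continuousAt_iff.1 hGc.continuousAt (ε / (2 * (b - a + 1)))
    (div_pos hε (by linarith))
  have hev : ∀ᶠ n : ℕ in Filter.atTop, (b - a) / n < r :=
    (tendsto_const_div_atTop_nhds_zero_nat (b - a)).eventually_lt_const hr
  filter_upwards [hev, Filter.eventually_gt_atTop 0] with n hn hn0
  have hn' : (0 : ℝ) < n := by exact_mod_cast hn0
  rw [Real.dist_eq, sub_zero, abs_of_nonneg (integral_nonneg fun x => abs_nonneg _)]
  set d := (b - a) / n with hd
  have hd0 : 0 ≤ d := div_nonneg (sub_nonneg.2 hab) hn'.le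
  have hnd : n * d = b - a := by rw [hd]; field_simp
  have hle : ∀ k : Fin n, a + k * d ≤ a + (k + 1) * d := fun k => by nlinarith
  have hprod : ∀ k : Fin n, Integrable (fun p : ℝ × Ω => |ξ (a + k * d) p.2 - ξ p.1 p.2|)
      ((volume.restrict (Set.Ioc (a + k * d) (a + (k + 1) * d))).prod P) := fun k =>
    ((((h.memLp (a + k * d)).integrable (by norm_num)).comp_snd _).sub
      (h.integrable_prod _ _)).abs
  have hint : ∀ k : Fin n, Integrable (fun x => ∫ s in (a + k * d)..(a + (k + 1) * d),
      |ξ (a + k * d) x - ξ s x|) P := fun k => by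
    simp only [intervalIntegral.integral_of_le (hle k)]
    exact (hprod k).integral_prod_right
  have hcell : ∀ k : Fin n, ∫ x, (∫ s in (a + k * d)..(a + (k + 1) * d),
      |ξ (a + k * d) x - ξ s x|) ∂P ≤ ε / (2 * (b - a + 1)) * d := by
    intro k
    simp only [intervalIntegral.integral_of_le (hle k)]
    rw [← integral_integral_swap (f := fun s x => |ξ (a + k * d) x - ξ s x|) (hprod k)]
    have hb : ∀ s ∈ Set.Ioc (a + k * d) (a + (k + 1) * d),
        ‖∫ x, |ξ (a + k * d) x - ξ s x| ∂P‖ ≤ ε / (2 * (b - a + 1)) := by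
      intro s hs
      rw [Real.norm_eq_abs, abs_of_nonneg (integral_nonneg fun x => abs_nonneg _)]
      refine (h.integral_abs_sub_le _ _).trans ?_
      have hdist : dist (a + k * d - s) 0 < r := by
        rw [Real.dist_eq, sub_zero, abs_lt]
        constructor <;> nlinarith [hs.1, hs.2]
      have := hr' hdist
      rw [hG0, Real.dist_eq, sub_zero] at this
      exact (le_abs_self _).trans this.le
    have := norm_setIntegral_le_of_norm_le_const (μ := volume) measure_Ioc_lt_top hb
    refine (Real.le_norm_self _).trans (this.trans (le_of_eq ?_))
    rw [Measure.real, Real.volume_Ioc, ENNReal.toReal_ofReal (by linarith [hle k])]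
    ring
  calc ∫ x, |∑ k : Fin n, d * ξ (a + k * d) x - ∫ s in a..b, ξ s x| ∂P
      ≤ ∫ x, (∑ k : Fin n, ∫ s in (a + k * d)..(a + (k + 1) * d), |ξ (a + k * d) x - ξ s x|) ∂P := by
        refine integral_mono_of_nonneg (Filter.Eventually.of_forall fun x => abs_nonneg _)
          (integrable_finsetSum _ fun k _ => hint k) ?_
        filter_upwards [h.ae_intervalIntegrable hab] with x hx
        simpa using norm_riemannSum_sub_integral_le hab hx hn0
    _ = ∑ k : Fin n, ∫ x, (∫ s in (a + k * d)..(a + (k + 1) * d),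
          |ξ (a + k * d) x - ξ s x|) ∂P :=
        integral_finsetSum _ fun k _ => hint k
    _ ≤ ∑ k : Fin n, ε / (2 * (b - a + 1)) * d := Finset.sum_le_sum fun k _ => hcell k
    _ = ε * ((b - a) / (2 * (b - a + 1))) := by
        rw [Finset.sum_const, Finset.card_univ, Fintype.card_fin, nsmul_eq_mul, ← hnd]; ring
    _ < ε := by
        refine mul_lt_of_lt_one_right hε ?_
        rw [div_lt_one (by linarith)]; linarith

end Noise

lemma norm_exp_I_mul_sub_le (u v : ℝ) :
    ‖Complex.exp (Complex.I * (u : ℂ)) - Complex.exp (Complex.I * (v : ℂ))‖ ≤ |u - v| := by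
  have : Complex.exp (Complex.I * (u : ℂ)) - Complex.exp (Complex.I * (v : ℂ)) =
      Complex.exp (Complex.I * (v : ℂ)) * (Complex.exp (Complex.I * ((u - v : ℝ) : ℂ)) - 1) := by
    rw [mul_sub, ← Complex.exp_add, mul_one]; push_cast; ring_nf
  rw [this, norm_mul, mul_comm Complex.I (v : ℂ), Complex.norm_exp_ofReal_mul_I, one_mul]
  exact Real.norm_exp_I_mul_ofReal_sub_one_le

lemma tendsto_riemannSum_exp (w : ℝ) {a b : ℝ} (hab : a ≤ b) :
    Filter.Tendsto (fun n : ℕ => ∑ k : Fin n, (((b - a) / n : ℝ) : ℂ) *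
      Complex.exp (Complex.I * ((w * (a + k * ((b - a) / n)) : ℝ) : ℂ))) Filter.atTop
      (nhds (∫ s in a..b, Complex.exp (Complex.I * ((w * s : ℝ) : ℂ)))) := by
  have hz : Filter.Tendsto (fun n : ℕ => |w| * (b - a) * ((b - a) / n)) Filter.atTop (nhds 0) := by
    simpa using (tendsto_const_div_atTop_nhds_zero_nat (b - a)).const_mul (|w| * (b - a))
  refine tendsto_iff_norm_sub_tendsto_zero.2 (squeeze_zero' (Filter.Eventually.of_forall
    fun n => norm_nonneg _) ?_ hz)
  filter_upwards [Filter.eventually_gt_atTop 0] with n hn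
  have hn' : (0 : ℝ) < n := by exact_mod_cast hn
  have hcont : Continuous fun s : ℝ => Complex.exp (Complex.I * ((w * s : ℝ) : ℂ)) := by fun_prop
  have hR := norm_riemannSum_sub_integral_le hab (hcont.intervalIntegrable a b) hn
  simp only [Complex.real_smul] at hR
  refine hR.trans ?_
  set d := (b - a) / n with hd
  have hd0 : 0 ≤ d := div_nonneg (sub_nonneg.2 hab) hn'.le
  have hnd : n * d = b - a := by rw [hd]; field_simp
  have hcell : ∀ k : Fin n, ∫ s in (a + k * d)..(a + (k + 1) * d),
      ‖Complex.exp (Complex.I * ((w * (a + k * d) : ℝ) : ℂ)) -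
        Complex.exp (Complex.I * ((w * s : ℝ) : ℂ))‖ ≤ |w| * d * d := by
    intro k
    have hle : a + k * d ≤ a + (k + 1) * d := by nlinarith
    have := intervalIntegral.norm_integral_le_of_norm_le_const (a := a + k * d)
      (b := a + (k + 1) * d) (C := |w| * d)
      (f := fun s => ‖Complex.exp (Complex.I * ((w * (a + k * d) : ℝ) : ℂ)) -
        Complex.exp (Complex.I * ((w * s : ℝ) : ℂ))‖) (fun s hs => by
        rw [Set.uIoc_of_le hle] at hs
        rw [norm_norm]
        refine (norm_exp_I_mul_sub_le _ _).trans ?_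
        rw [← mul_sub, abs_mul]
        refine mul_le_mul_of_nonneg_left ?_ (abs_nonneg w)
        rw [abs_le]
        constructor <;> nlinarith [hs.1, hs.2])
    refine (Real.le_norm_self _).trans (this.trans (le_of_eq ?_))
    have : a + (k + 1) * d - (a + k * d) = d := by ring
    rw [this, abs_of_nonneg hd0]
  refine (Finset.sum_le_sum fun k _ => hcell k).trans (le_of_eq ?_)
  rw [Finset.sum_const, Finset.card_univ, Fintype.card_fin, nsmul_eq_mul, ← hnd]; ring

end CollectiveDephasing

namespace CollectiveDephasing

/-! ## Joint Gaussianity of the segment integrals and the score variable -/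

/-- Linear combination of the integrals of the noise over the cells of the partition `t`. -/
noncomputable def noiseSum {Ω : Type*} {n : ℕ} (t : Fin (n + 1) → ℝ) (ξ : ℝ → Ω → ℝ)
    (w : Fin n → ℝ) (x : Ω) : ℝ :=
  ∑ j, w j * ∫ s in (t j.castSucc)..(t j.succ), ξ s x

/-- Variance of `noiseSum` for noise of spectrum `S`. -/
noncomputable def noiseVar {n : ℕ} (S : ℝ → ℝ) (t : Fin (n + 1) → ℝ) (w : Fin n → ℝ) : ℝ :=
  (2 * Real.pi)⁻¹ * ∫ y, S y * ‖stepTransform t w y‖ ^ 2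

lemma noiseSum_add {Ω : Type*} {n : ℕ} (t : Fin (n + 1) → ℝ) (ξ : ℝ → Ω → ℝ)
    (w w' : Fin n → ℝ) (x : Ω) : noiseSum t ξ (w + w') x = noiseSum t ξ w x + noiseSum t ξ w' x := by
  simp [noiseSum, add_mul, Finset.sum_add_distrib]

lemma noiseSum_smul {Ω : Type*} {n : ℕ} (t : Fin (n + 1) → ℝ) (ξ : ℝ → Ω → ℝ) (a : ℝ)
    (w : Fin n → ℝ) (x : Ω) : noiseSum t ξ (a • w) x = a * noiseSum t ξ w x := by
  simp [noiseSum, mul_assoc, Finset.mul_sum]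

section Noise

variable {Ω : Type*} [MeasurableSpace Ω] {P : Measure Ω} {ξ : ℝ → Ω → ℝ} {S : ℝ → ℝ} {n : ℕ}
  {t : Fin (n + 1) → ℝ}

lemma IsStationaryGaussianNoise.measurable_noiseSum (h : IsStationaryGaussianNoise P ξ S)
    (ht : Monotone t) (w : Fin n → ℝ) : Measurable (noiseSum t ξ w) := by
  unfold noiseSum
  refine Finset.measurable_sum _ fun j _ => Measurable.const_mul ?_ _
  exact h.measurable_integral (ht (Fin.castSucc_le_succ j))

variable [IsProbabilityMeasure P]

lemma integrable_exp_I_mul {Y : Ω → ℝ} (hY : AEStronglyMeasurable Y P) :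
    Integrable (fun x => Complex.exp (Complex.I * (Y x : ℂ))) P := by
  refine Integrable.of_bound (C := 1) ?_ (Filter.Eventually.of_forall fun x => ?_)
  · exact (by fun_prop : Continuous fun u : ℝ =>
      Complex.exp (Complex.I * (u : ℂ))).comp_aestronglyMeasurable hY
  · rw [mul_comm, Complex.norm_exp_ofReal_mul_I]

/-- The characteristic function of the segment integrals of the noise. -/
lemma IsStationaryGaussianNoise.integral_exp_noiseSum (h : IsStationaryGaussianNoise P ξ S)
    (hS : Integrable S) (ht : Monotone t) (w : Fin n → ℝ) :
    ∫ x, Complex.exp (Complex.I * (noiseSum t ξ w x : ℂ)) ∂P =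
      Complex.exp (-(noiseVar S t w : ℂ) / 2) := by
  set d : ℕ → Fin n → ℝ := fun m j => (t j.succ - t j.castSucc) / m with hd
  set p : ℕ → Fin n → ℕ → ℝ := fun m j k => t j.castSucc + k * d m j with hp
  set R : ℕ → Ω → ℝ := fun m x => ∑ j, w j * ∑ k : Fin m, d m j * ξ (p m j k) x with hR
  set A : ℕ → ℝ → ℂ := fun m y => ∑ j, (w j : ℂ) * ∑ k : Fin m, (d m j : ℂ) *
    Complex.exp (Complex.I * ((y * p m j k : ℝ) : ℂ)) with hA
  have hle : ∀ j : Fin n, t j.castSucc ≤ t j.succ := fun j => ht (Fin.castSucc_le_succ j)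
  have hξi : ∀ s, Integrable (ξ s) P := fun s => (h.memLp s).integrable (by norm_num)
  have hcell : ∀ m j, Integrable (fun x => ∑ k : Fin m, d m j * ξ (p m j k) x) P := fun m j =>
    integrable_finsetSum _ fun k _ => (hξi _).const_mul _
  have hRi : ∀ m, Integrable (R m) P := fun m =>
    integrable_finsetSum _ fun j _ => (hcell m j).const_mul _
  have hXi : Integrable (noiseSum t ξ w) P :=
    integrable_finsetSum _ fun j _ => (h.integrable_integral (hle j)).const_mul _
  -- Only finitely many noise values are known to be jointly Gaussian, so the integrals are
  -- approximated in mean by Riemann sums. Characteristic functions follow, as `r ↦ exp (i r)` is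
  -- 1-Lipschitz; the spectral variances follow by dominated convergence.
  have hconv : Filter.Tendsto (fun m => ∫ x, |R m x - noiseSum t ξ w x| ∂P) Filter.atTop
      (nhds 0) := by
    have hsum : Filter.Tendsto (fun m : ℕ => ∑ j, |w j| * ∫ x, |∑ k : Fin m, d m j * ξ (p m j k) x -
        ∫ s in (t j.castSucc)..(t j.succ), ξ s x| ∂P) Filter.atTop (nhds 0) := by
      have := tendsto_finsetSum Finset.univ fun j (_ : j ∈ Finset.univ) =>
        (h.tendsto_riemannSum hS (hle j)).const_mul |w j|
      simpa using this
    refine squeeze_zero (fun m => integral_nonneg fun x => abs_nonneg _) (fun m => ?_) hsum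
    have hi : ∀ j ∈ Finset.univ, Integrable (fun x => |w j| * |∑ k : Fin m, d m j * ξ (p m j k) x -
        ∫ s in (t j.castSucc)..(t j.succ), ξ s x|) P := fun j _ =>
      ((hcell m j).sub (h.integrable_integral (hle j))).abs.const_mul _
    simp_rw [← integral_const_mul]
    rw [← integral_finsetSum _ hi]
    refine integral_mono ((hRi m).sub hXi).abs (integrable_finsetSum _ hi) fun x => ?_
    simp only [hR, noiseSum]
    rw [← Finset.sum_sub_distrib]
    refine (Finset.abs_sum_le_sum_abs _ _).trans (le_of_eq (Finset.sum_congr rfl fun j _ => ?_))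
    rw [← mul_sub, abs_mul]
  have hlim1 : Filter.Tendsto (fun m => ∫ x, Complex.exp (Complex.I * (R m x : ℂ)) ∂P) Filter.atTop
      (nhds (∫ x, Complex.exp (Complex.I * (noiseSum t ξ w x : ℂ)) ∂P)) := by
    refine tendsto_iff_norm_sub_tendsto_zero.2 (squeeze_zero (fun m => norm_nonneg _)
      (fun m => ?_) hconv)
    rw [← integral_sub (integrable_exp_I_mul (hRi m).aestronglyMeasurable)
      (integrable_exp_I_mul hXi.aestronglyMeasurable)]
    refine (norm_integral_le_integral_norm _).trans (integral_mono ?_ ((hRi m).sub hXi).abs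
      fun x => norm_exp_I_mul_sub_le _ _)
    exact ((integrable_exp_I_mul (hRi m).aestronglyMeasurable).sub
      (integrable_exp_I_mul hXi.aestronglyMeasurable)).norm
  have hchar : ∀ m, ∫ x, Complex.exp (Complex.I * (R m x : ℂ)) ∂P =
      Complex.exp (-(((2 * Real.pi)⁻¹ * ∫ y, S y * ‖A m y‖ ^ 2 : ℝ) : ℂ) / 2) := by
    intro m
    have := h.integral_exp_sum hS (ι := Fin n × Fin m) (fun q => w q.1 * d m q.1)
      (fun q => p m q.1 q.2)
    simp only [Fintype.sum_prod_type] at this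
    convert this using 6 with x y
    · simp only [hR, Finset.mul_sum, mul_assoc]
    · congr 3
      ext y
      simp only [hA, Finset.mul_sum, mul_assoc, Complex.ofReal_mul]
  have hAlim : ∀ y, Filter.Tendsto (fun m => A m y) Filter.atTop (nhds (stepTransform t w y)) :=
    fun y => tendsto_finsetSum _ fun j _ => (tendsto_riemannSum_exp y (hle j)).const_mul _
  have hAb : ∀ m y, ‖A m y‖ ≤ ∑ j, |w j| * (t j.succ - t j.castSucc) := by
    intro m y
    refine (norm_sum_le _ _).trans (Finset.sum_le_sum fun j _ => ?_)
    rw [norm_mul, Complex.norm_real, Real.norm_eq_abs]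
    refine mul_le_mul_of_nonneg_left ?_ (abs_nonneg _)
    have h0 : 0 ≤ t j.succ - t j.castSucc := sub_nonneg.2 (hle j)
    calc ‖∑ k : Fin m, (d m j : ℂ) * Complex.exp (Complex.I * ((y * p m j k : ℝ) : ℂ))‖
        ≤ ∑ k : Fin m, d m j := by
          refine (norm_sum_le _ _).trans (Finset.sum_le_sum fun k _ => ?_)
          rw [norm_mul, mul_comm Complex.I, Complex.norm_exp_ofReal_mul_I, mul_one,
            Complex.norm_real, Real.norm_eq_abs, abs_of_nonneg]
          exact div_nonneg h0 (Nat.cast_nonneg _)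
      _ = m * d m j := by simp
      _ ≤ t j.succ - t j.castSucc := by
          rcases Nat.eq_zero_or_pos m with rfl | hm
          · simpa using h0
          · have hm' : (m : ℝ) ≠ 0 := by positivity
            exact le_of_eq (by simp only [hd]; field_simp)
  have hlim2 : Filter.Tendsto (fun m => ∫ y, S y * ‖A m y‖ ^ 2) Filter.atTop
      (nhds (∫ y, S y * ‖stepTransform t w y‖ ^ 2)) := by
    refine tendsto_integral_of_dominated_convergence
      (fun y => ‖S y‖ * (∑ j, |w j| * (t j.succ - t j.castSucc)) ^ 2) (fun m => ?_)
      (hS.norm.mul_const _) (fun m => Filter.Eventually.of_forall fun y => ?_)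
      (Filter.Eventually.of_forall fun y => ((hAlim y).norm.pow 2).const_mul _)
    · refine hS.aestronglyMeasurable.mul (Continuous.aestronglyMeasurable ?_)
      simp only [hA]
      fun_prop
    · rw [norm_mul, Real.norm_eq_abs (_ ^ 2), abs_of_nonneg (by positivity)]
      gcongr
      exact hAb m y
  refine tendsto_nhds_unique hlim1 ?_
  simp only [hchar]
  have hc : Continuous fun u : ℝ => Complex.exp (-(((2 * Real.pi)⁻¹ * u : ℝ) : ℂ) / 2) := by
    fun_prop
  exact (hc.tendsto _).comp hlim2

lemma noiseVar_nonneg (hS0 : ∀ y, 0 ≤ S y) (w : Fin n → ℝ) : 0 ≤ noiseVar S t w := by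
  refine mul_nonneg (by positivity) (integral_nonneg fun y => mul_nonneg (hS0 y) (by positivity))

lemma stepTransform_smul (a : ℝ) (w : Fin n → ℝ) (y : ℝ) :
    stepTransform t (a • w) y = a * stepTransform t w y := by
  simp [stepTransform, mul_assoc, Finset.mul_sum]

lemma noiseVar_smul (a : ℝ) (w : Fin n → ℝ) : noiseVar S t (a • w) = a ^ 2 * noiseVar S t w := by
  simp only [noiseVar, stepTransform_smul, norm_mul, Complex.norm_real, mul_pow,
    Real.norm_eq_abs, sq_abs, mul_left_comm _ (a ^ 2), integral_const_mul]

/-- The formula `integral_exp_noiseSum` for the weights `θ • w` is the characteristic function of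
the law at `θ`, and it determines the law. -/
lemma IsStationaryGaussianNoise.map_noiseSum (h : IsStationaryGaussianNoise P ξ S)
    (hS : Integrable S) (hS0 : ∀ y, 0 ≤ S y) (ht : Monotone t) (w : Fin n → ℝ) :
    P.map (noiseSum t ξ w) = gaussianReal 0 (noiseVar S t w).toNNReal := by
  have hm := h.measurable_noiseSum ht w
  have := Measure.isProbabilityMeasure_map (μ := P) hm.aemeasurable
  refine Measure.ext_of_charFun ?_
  ext θ
  rw [charFun_gaussianReal, charFun_apply_real, integral_map hm.aemeasurable (by fun_prop),
    Real.coe_toNNReal _ (noiseVar_nonneg hS0 w)]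
  have := h.integral_exp_noiseSum hS ht (θ • w)
  rw [noiseVar_smul] at this
  convert this using 2
  · ext x
    rw [noiseSum_smul]; push_cast; ring_nf
  · push_cast; ring

lemma IsStationaryGaussianNoise.memLp_noiseSum (h : IsStationaryGaussianNoise P ξ S)
    (hS : Integrable S) (hS0 : ∀ y, 0 ≤ S y) (ht : Monotone t) (w : Fin n → ℝ) :
    MemLp (noiseSum t ξ w) 2 P := by
  have : HasGaussianLaw (noiseSum t ξ w) P := ⟨by rw [h.map_noiseSum hS hS0 ht]; infer_instance⟩
  exact this.memLp_two

lemma IsStationaryGaussianNoise.integral_noiseSum_sq (h : IsStationaryGaussianNoise P ξ S)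
    (hS : Integrable S) (hS0 : ∀ y, 0 ≤ S y) (ht : Monotone t) (w : Fin n → ℝ) :
    ∫ x, noiseSum t ξ w x ^ 2 ∂P = noiseVar S t w := by
  have hm := (h.measurable_noiseSum ht w).aemeasurable (μ := P)
  have h1 := variance_fun_id_gaussianReal (μ := 0) (v := (noiseVar S t w).toNNReal)
  have h0 := integral_id_gaussianReal (μ := 0) (v := (noiseVar S t w).toNNReal)
  rw [variance_of_integral_eq_zero (X := fun x : ℝ => x) (by fun_prop) h0, ← h.map_noiseSum hS hS0 ht w,
    integral_map hm (by fun_prop), Real.coe_toNNReal _ (noiseVar_nonneg hS0 w)] at h1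
  exact h1

/-- The covariance form of the segment integrals. -/
noncomputable def IsStationaryGaussianNoise.covForm (h : IsStationaryGaussianNoise P ξ S)
    (hS : Integrable S) (hS0 : ∀ y, 0 ≤ S y) (ht : Monotone t) :
    (Fin n → ℝ) →ₗ[ℝ] (Fin n → ℝ) →ₗ[ℝ] ℝ :=
  have hi : ∀ w w', Integrable (fun x => noiseSum t ξ w x * noiseSum t ξ w' x) P := fun w w' =>
    (h.memLp_noiseSum hS hS0 ht w).integrable_mul (h.memLp_noiseSum hS hS0 ht w')
  LinearMap.mk₂ ℝ (fun w w' => ∫ x, noiseSum t ξ w x * noiseSum t ξ w' x ∂P)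
    (fun u v w => by
      simp only [noiseSum_add, add_mul]
      exact integral_add (hi _ _) (hi _ _))
    (fun a u v => by simp only [noiseSum_smul, mul_assoc, integral_const_mul, smul_eq_mul])
    (fun u v w => by
      simp only [noiseSum_add, mul_add]
      exact integral_add (hi _ _) (hi _ _))
    (fun a u v => by
      simp only [noiseSum_smul, mul_left_comm _ a, integral_const_mul, smul_eq_mul])

/-- Gaussian integration by parts for the segment integrals. -/
lemma IsStationaryGaussianNoise.integral_noiseSum_mul_exp (h : IsStationaryGaussianNoise P ξ S)
    (hS : Integrable S) (hS0 : ∀ y, 0 ≤ S y) (ht : Monotone t) (w u : Fin n → ℝ) :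
    ∫ x, (noiseSum t ξ w x : ℂ) * Complex.exp (Complex.I * (noiseSum t ξ u x : ℂ)) ∂P =
      Complex.I * (h.covForm hS hS0 ht u w : ℂ) *
        ∫ x, Complex.exp (Complex.I * (noiseSum t ξ u x : ℂ)) ∂P := by
  set B := h.covForm hS hS0 ht with hB
  have hBv : ∀ v, noiseVar S t v = B v v := fun v => by
    rw [← h.integral_noiseSum_sq hS hS0 ht]
    simp only [sq]; rfl
  have hsymm : ∀ v v', B v v' = B v' v := fun v v' => by
    show ∫ x, noiseSum t ξ v x * noiseSum t ξ v' x ∂P = ∫ x, noiseSum t ξ v' x * noiseSum t ξ v x ∂P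
    simp only [mul_comm]
  have hWi : Integrable (noiseSum t ξ w) P :=
    (h.memLp_noiseSum hS hS0 ht w).integrable (by norm_num)
  have hms : ∀ v, AEStronglyMeasurable (noiseSum t ξ v) P := fun v =>
    (h.memLp_noiseSum hS hS0 ht v).aestronglyMeasurable
  have hcont : Continuous fun r : ℝ => Complex.exp (Complex.I * (r : ℂ)) := by fun_prop
  -- The characteristic function of `u + θ w` is differentiated at `θ = 0` in two ways: under the
  -- integral, and in the closed form where the covariance of `u` and `w` is half the coefficient of
  -- `θ`.
  have hpt : ∀ x (θ : ℝ), HasDerivAt (fun θ : ℝ => Complex.exp (Complex.I *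
      (noiseSum t ξ (u + θ • w) x : ℂ))) (Complex.exp (Complex.I *
      (noiseSum t ξ (u + θ • w) x : ℂ)) * (Complex.I * noiseSum t ξ w x)) θ := by
    intro x θ
    have e : ∀ θ : ℝ, Complex.I * (noiseSum t ξ (u + θ • w) x : ℂ) =
        Complex.I * noiseSum t ξ u x + (Complex.I * noiseSum t ξ w x) * (θ : ℂ) := fun θ => by
      rw [noiseSum_add, noiseSum_smul]; push_cast; ring
    simp only [e]
    have h1 := ((Complex.ofRealCLM.hasDerivAt (x := θ)).const_mul
      (Complex.I * (noiseSum t ξ w x : ℂ))).const_add (Complex.I * (noiseSum t ξ u x : ℂ))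
    simpa using h1.cexp
  have hderiv := (hasDerivAt_integral_of_dominated_loc_of_deriv_le (μ := P)
    (F := fun θ x => Complex.exp (Complex.I * (noiseSum t ξ (u + θ • w) x : ℂ)))
    (F' := fun θ x => Complex.exp (Complex.I * (noiseSum t ξ (u + θ • w) x : ℂ)) *
      (Complex.I * noiseSum t ξ w x))
    (x₀ := (0 : ℝ)) (s := Set.univ) (bound := fun x => ‖noiseSum t ξ w x‖) Filter.univ_mem
    (Filter.Eventually.of_forall fun θ => hcont.comp_aestronglyMeasurable (hms _))
    (integrable_exp_I_mul (hms _))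
    ((hcont.comp_aestronglyMeasurable (hms _)).mul
      ((Complex.continuous_ofReal.comp_aestronglyMeasurable (hms w)).const_mul _))
    (Filter.Eventually.of_forall fun x θ _ => by
      rw [norm_mul, mul_comm Complex.I (noiseSum t ξ (u + θ • w) x : ℂ),
        Complex.norm_exp_ofReal_mul_I, one_mul, norm_mul, Complex.norm_I, one_mul,
        Complex.norm_real])
    hWi.norm (Filter.Eventually.of_forall fun x θ _ => hpt x θ)).2
  have hexp : ∀ θ : ℝ, ∫ x, Complex.exp (Complex.I * (noiseSum t ξ (u + θ • w) x : ℂ)) ∂P =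
      Complex.exp (-((B u u : ℂ) + 2 * θ * B u w + θ ^ 2 * B w w) / 2) := by
    intro θ
    rw [h.integral_exp_noiseSum hS ht, hBv]
    simp only [map_add, LinearMap.add_apply, map_smul, LinearMap.smul_apply, smul_eq_mul,
      hsymm w u]
    push_cast; ring_nf
  have hderiv2 : HasDerivAt (fun θ : ℝ =>
      Complex.exp (-((B u u : ℂ) + 2 * θ * B u w + θ ^ 2 * B w w) / 2))
      (Complex.exp (-(B u u : ℂ) / 2) * (-(B u w : ℂ))) 0 := by
    have h0 : HasDerivAt (fun θ : ℝ => (θ : ℂ)) 1 0 := by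
      simpa using (hasDerivAt_id (0 : ℝ)).ofReal_comp
    have h1 := ((((h0.const_mul 2).mul_const (B u w : ℂ)).const_add (B u u : ℂ)).add
      ((h0.pow 2).mul_const (B w w : ℂ))).neg.div_const 2
    have h2 := h1.cexp
    refine (h2.congr_deriv ?_).congr_of_eventuallyEq (Filter.Eventually.of_forall fun θ => ?_)
    · simp; ring
    · simp
  simp only [hexp] at hderiv
  have huniq := hderiv.unique hderiv2
  simp only [zero_smul, add_zero] at huniq
  rw [h.integral_exp_noiseSum hS ht, hBv u]
  have hfac : ∫ x, Complex.exp (Complex.I * (noiseSum t ξ u x : ℂ)) *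
      (Complex.I * noiseSum t ξ w x) ∂P = Complex.I *
      ∫ x, (noiseSum t ξ w x : ℂ) * Complex.exp (Complex.I * (noiseSum t ξ u x : ℂ)) ∂P := by
    rw [← integral_const_mul]
    exact integral_congr_ae (Filter.Eventually.of_forall fun x => by ring)
  rw [hfac] at huniq
  have hI : ∀ z : ℂ, z = -Complex.I * (Complex.I * z) := fun z => by
    rw [← mul_assoc, neg_mul, Complex.I_mul_I]; ring
  rw [hI (∫ x, (noiseSum t ξ w x : ℂ) * Complex.exp (Complex.I * (noiseSum t ξ u x : ℂ)) ∂P), huniq]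
  ring

end Noise

/-- A functional dominated by a nonnegative quadratic form is represented by that form. -/
lemma exists_represent_of_sq_le {V : Type*} [AddCommGroup V] [Module ℝ V] [FiniteDimensional ℝ V]
    (B : V →ₗ[ℝ] V →ₗ[ℝ] ℝ) (l : Module.Dual ℝ V) (K : ℝ) (hK : 0 ≤ K)
    (h : ∀ v, l v ^ 2 ≤ K * B v v) : ∃ w, (∀ u, B u w = l u) ∧ B w w ≤ K := by
  -- The form may be degenerate, as cells may be empty, so it is not inverted. The inequality makes
  -- `l` vanish on the kernel, hence `l` factors through `B`, and by reflexivity the factor is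
  -- evaluation at some `w`. The hypothesis at `w` itself reads `B(w,w)² ≤ K B(w,w)`.
  have hl : l ∈ (LinearMap.ker B).dualAnnihilator := by
    rw [Submodule.mem_dualAnnihilator]
    intro v hv
    have := h v
    rw [LinearMap.mem_ker.1 hv, LinearMap.zero_apply, mul_zero] at this
    exact pow_eq_zero_iff (two_ne_zero) |>.1 (le_antisymm this (sq_nonneg _))
  rw [← LinearMap.range_dualMap_eq_dualAnnihilator_ker] at hl
  obtain ⟨Φ, hΦ⟩ := hl
  obtain ⟨w, rfl⟩ := (Module.evalEquiv ℝ V).surjective Φ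
  have hw : ∀ u, B u w = l u := fun u => by rw [← hΦ]; rfl
  refine ⟨w, hw, ?_⟩
  have h1 := h w
  rw [← hw w] at h1
  by_contra! hcon
  nlinarith

/-- Time is measured in units of `1 / ωc`. The prefactor of the spectrum and the Jacobian together
supply the `ωc ^ 2` by which the squared transform of the rescaled partition grows. -/
lemma noiseVar_noiseSpectrum {n : ℕ} (σ : ℝ → ℝ) {ωc : ℝ} (hωc : 0 < ωc) (t : Fin (n + 1) → ℝ)
    (w : Fin n → ℝ) :
    noiseVar (noiseSpectrum σ ωc) t w =
      (2 * Real.pi)⁻¹ * ∫ y, σ y * ‖stepTransform (fun j => ωc * t j) w y‖ ^ 2 := by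
  have hV : ∀ y, stepTransform (fun j => ωc * t j) w (y / ωc) = ωc * stepTransform t w y := by
    intro y
    simp only [stepTransform, Finset.mul_sum]
    refine Finset.sum_congr rfl fun j _ => ?_
    have := intervalIntegral.smul_integral_comp_mul_left (a := t j.castSucc) (b := t j.succ)
      (f := fun s : ℝ => Complex.exp (Complex.I * ((y / ωc * s : ℝ) : ℂ))) ωc
    rw [← this]
    have e : ∀ s : ℝ, y / ωc * (ωc * s) = y * s := fun s => by field_simp
    simp only [e, Complex.real_smul]
    ring
  have hsub := Measure.integral_comp_div
    (fun y => σ y * ‖stepTransform (fun j => ωc * t j) w y‖ ^ 2) ωc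
  have hωa : |ωc| = ωc := abs_of_pos hωc
  rw [noiseVar]
  congr 1
  simp only [hV, norm_mul, Complex.norm_real, Real.norm_eq_abs, hωa, smul_eq_mul] at hsub
  have h2 : ∫ y, σ (y / ωc) * (ωc * ‖stepTransform t w y‖) ^ 2 =
      ωc * ∫ y, noiseSpectrum σ ωc y * ‖stepTransform t w y‖ ^ 2 := by
    rw [← integral_const_mul]
    exact integral_congr_ae (Filter.Eventually.of_forall fun y => by
      simp only [noiseSpectrum]; ring)
  rw [h2] at hsub
  exact mul_left_cancel₀ hωc.ne' hsub

/-- Existence of a square-integrable score for the signal: a random variable whose product with a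
trigonometric function of the noise phases averages to its derivative along the signal. Its second
moment is bounded in terms of the profile, the cutoff and the number of segments only. -/
lemma IsSpectralProfile.exists_score {σ : ℝ → ℝ} (hσ : IsSpectralProfile σ) (n : ℕ) :
    ∃ K : ℝ, 0 < K ∧ ∀ ωc : ℝ, 0 < ωc → ∀ (Ω : Type*) [MeasurableSpace Ω] (P : Measure Ω)
      [IsProbabilityMeasure P] (ξ : ℝ → Ω → ℝ), IsStationaryGaussianNoise P ξ (noiseSpectrum σ ωc) →
      ∀ t : Fin (n + 1) → ℝ, Monotone t → (∀ j, 0 ≤ t j ∧ ωc * t j ≤ 1) →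
      ∃ W : Ω → ℝ, MemLp W 2 P ∧ ∫ x, W x ^ 2 ∂P ≤ K / ωc ^ 2 ∧
        ∀ u : Fin n → ℝ,
          ∫ x, (W x : ℂ) * Complex.exp (Complex.I * (noiseSum t ξ u x : ℂ)) ∂P =
          Complex.I * ((∑ j, u j * (t j.succ - t j.castSucc) : ℝ) : ℂ) *
            ∫ x, Complex.exp (Complex.I * (noiseSum t ξ u x : ℂ)) ∂P := by
  obtain ⟨K, hK, H⟩ := hσ.exists_mean_sq_le n
  refine ⟨2 * Real.pi * K, by positivity, fun ωc hωc Ω _ P _ ξ h t ht htb => ?_⟩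
  have hS : Integrable (noiseSpectrum σ ωc) := (hσ.integrable.comp_div hωc.ne').const_mul ωc
  have hS0 : ∀ y, 0 ≤ noiseSpectrum σ ωc y := fun y => mul_nonneg hωc.le (hσ.nonneg _)
  set B := h.covForm hS hS0 ht with hB
  let l : Module.Dual ℝ (Fin n → ℝ) :=
    ∑ j, (t j.succ - t j.castSucc) • LinearMap.proj j
  have hl : ∀ u, l u = ∑ j, u j * (t j.succ - t j.castSucc) := fun u => by
    simp [l, mul_comm]
  have hBv : ∀ v, B v v = noiseVar (noiseSpectrum σ ωc) t v := fun v => by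
    rw [← h.integral_noiseSum_sq hS hS0 ht]
    simp only [sq]; rfl
  -- `2π` undoes the normalisation of `noiseVar`, and `ωc ^ 2` appears because the mean over the
  -- rescaled partition is `ωc * l v`. The resulting `noiseSum t ξ w` is the score.
  obtain ⟨w, hw1, hw2⟩ := exists_represent_of_sq_le B l (2 * Real.pi * K / ωc ^ 2) (by positivity)
    (fun v => by
      have h1 := H (fun j => ωc * t j)
        (fun j => ⟨mul_nonneg hωc.le (htb j).1, (htb j).2⟩) v
      have h2 : ∑ j, v j * (ωc * t j.succ - ωc * t j.castSucc) = ωc * l v := by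
        rw [hl, Finset.mul_sum]
        exact Finset.sum_congr rfl fun j _ => by ring
      rw [h2] at h1
      rw [hBv, noiseVar_noiseSpectrum σ hωc, div_mul_eq_mul_div, le_div_iff₀ (by positivity)]
      calc l v ^ 2 * ωc ^ 2 = (ωc * l v) ^ 2 := by ring
        _ ≤ _ := h1
        _ = _ := by field_simp)
  refine ⟨noiseSum t ξ w, h.memLp_noiseSum hS hS0 ht w, ?_, fun u => ?_⟩
  · rw [h.integral_noiseSum_sq hS hS0 ht, ← hBv]
    exact hw2
  · rw [h.integral_noiseSum_mul_exp hS hS0 ht, ← hB, hw1, hl]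

end CollectiveDephasing

namespace CollectiveDephasing

/-! ## Bounding the quantum Fisher information of an average of states -/

section

variable {n : Type*} [Fintype n] {Ω : Type*} [MeasurableSpace Ω] {P : Measure Ω}

lemma integral_trace_mul (A : Matrix n n ℂ) {M : Ω → Matrix n n ℂ} {R : Matrix n n ℂ}
    (hM : ∀ i j, Integrable (fun x => M x i j) P) (hR : ∀ i j, R i j = ∫ x, M x i j ∂P) :
    Integrable (fun x => (A * M x).trace) P ∧ ∫ x, (A * M x).trace ∂P = (A * R).trace := by
  simp only [Matrix.trace, Matrix.diag, Matrix.mul_apply]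
  have hi : ∀ i j, Integrable (fun x => A i j * M x j i) P := fun i j => (hM j i).const_mul _
  refine ⟨integrable_finsetSum _ fun i _ => integrable_finsetSum _ fun j _ => hi i j, ?_⟩
  rw [integral_finsetSum _ fun i _ => integrable_finsetSum _ fun j _ => hi i j]
  refine Finset.sum_congr rfl fun i _ => ?_
  rw [integral_finsetSum _ fun j _ => hi i j]
  exact Finset.sum_congr rfl fun j _ => by rw [integral_const_mul, hR]

variable [DecidableEq n]

open Classical in
/-- The symmetric logarithmic derivative attached to the quantum Fisher information. -/
lemma exists_symmetric_logarithmic_derivative (ρ : ℝ → Matrix n n ℂ) (b : ℝ)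
    (hρ : (ρ b).IsHermitian) (hD : (matDeriv ρ b).IsHermitian) :
    ∃ L : Matrix n n ℂ, L.IsHermitian ∧ (L * matDeriv ρ b).trace = (qfi ρ b : ℂ) ∧
      (L * L * ρ b).trace = (qfi ρ b : ℂ) := by
  set V : Matrix n n ℂ := (hρ.eigenvectorUnitary : Matrix n n ℂ) with hV
  set l := hρ.eigenvalues with hl
  have hVV : V.conjTranspose * V = 1 := Unitary.coe_star_mul_self hρ.eigenvectorUnitary
  set D := V.conjTranspose * matDeriv ρ b * V with hDd
  have hDh : ∀ i j, D j i = star (D i j) := by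
    have : D.IsHermitian := by
      rw [Matrix.IsHermitian, hDd]
      simp only [Matrix.conjTranspose_mul, Matrix.conjTranspose_conjTranspose, hD.eq, mul_assoc]
    exact fun i j => (this.apply j i).symm
  have hdiag : V.conjTranspose * ρ b * V = Matrix.diagonal (fun i => (l i : ℂ)) := by
    have := hρ.conjStarAlgAut_star_eigenvectorUnitary
    rw [Unitary.conjStarAlgAut_star_apply] at this
    exact this
  set c : n → n → ℝ := fun i j => if 0 < l i + l j then 2 / (l i + l j) else 0 with hc
  have hcs : ∀ i j, c i j = c j i := fun i j => by simp only [hc, add_comm]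
  have hF : qfi ρ b = ∑ i, ∑ j, c i j * ‖D i j‖ ^ 2 := by
    rw [qfi, dif_pos hρ, Finset.mul_sum]
    refine Finset.sum_congr rfl fun i _ => ?_
    rw [Finset.mul_sum]
    refine Finset.sum_congr rfl fun j _ => ?_
    simp only [hc]
    by_cases h : 0 < l i + l j
    · rw [if_pos h, if_pos h]; ring
    · rw [if_neg h, if_neg h]; ring
  have hsq : ∀ z : ℂ, z * star z = ((‖z‖ ^ 2 : ℝ) : ℂ) := fun z => by
    rw [Complex.star_def, Complex.mul_conj, Complex.normSq_eq_norm_sq]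
  set L : Matrix n n ℂ := Matrix.of fun i j => (c i j : ℂ) * D i j with hL
  have hLh : L.IsHermitian := by
    ext i j
    simp only [hL, Matrix.conjTranspose_apply, Matrix.of_apply, star_mul']
    rw [hDh i j, star_star, hcs j i, Complex.star_def, Complex.conj_ofReal]
  refine ⟨V * L * V.conjTranspose, ?_, ?_, ?_⟩
  · rw [Matrix.IsHermitian]
    simp only [Matrix.conjTranspose_mul, Matrix.conjTranspose_conjTranspose, hLh.eq, mul_assoc]
  · have : (V * L * V.conjTranspose * matDeriv ρ b).trace = (L * D).trace := by
      rw [hDd, mul_assoc, mul_assoc, Matrix.trace_mul_comm]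
      simp only [mul_assoc]
    rw [this, hF]
    simp only [Matrix.trace, Matrix.diag, Matrix.mul_apply, Complex.ofReal_sum]
    refine Finset.sum_congr rfl fun i _ => Finset.sum_congr rfl fun j _ => ?_
    simp only [hL, Matrix.of_apply]
    rw [hDh i j, mul_assoc, hsq, Complex.ofReal_mul]
  · have : (V * L * V.conjTranspose * (V * L * V.conjTranspose) * ρ b).trace =
        (L * L * Matrix.diagonal (fun i => (l i : ℂ))).trace := by
      have e : V * L * V.conjTranspose * (V * L * V.conjTranspose) * ρ b =
          V * (L * (V.conjTranspose * V) * L * V.conjTranspose * ρ b) := by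
        simp only [mul_assoc]
      rw [e, hVV, mul_one, Matrix.trace_mul_comm, ← hdiag]
      simp only [mul_assoc]
    rw [this]
    have h1 : (L * L * Matrix.diagonal (fun i => (l i : ℂ))).trace =
        ((∑ i, ∑ j, c i j ^ 2 * l i * ‖D i j‖ ^ 2 : ℝ) : ℂ) := by
      simp only [Matrix.trace, Matrix.diag, Matrix.mul_diagonal]
      simp only [Matrix.mul_apply, Complex.ofReal_sum, Finset.sum_mul]
      refine Finset.sum_congr rfl fun i _ => Finset.sum_congr rfl fun j _ => ?_
      simp only [hL, Matrix.of_apply]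
      rw [hDh i j, hcs j i, Complex.ofReal_mul, ← hsq]
      push_cast; ring
    rw [h1]
    congr 1
    -- Symmetrising replaces `l i` by `(l i + l j) / 2`, and `c² (l i + l j) = 2 c` holds also for
    -- the pairs where `c = 0`.
    have h2 : ∑ i, ∑ j, c i j ^ 2 * l i * ‖D i j‖ ^ 2 =
        ∑ i, ∑ j, c i j ^ 2 * l j * ‖D i j‖ ^ 2 := by
      rw [Finset.sum_comm]
      refine Finset.sum_congr rfl fun i _ => Finset.sum_congr rfl fun j _ => ?_
      rw [hcs, hDh i j, norm_star]
    have h3 : 2 * qfi ρ b = ∑ i, ∑ j, c i j ^ 2 * l i * ‖D i j‖ ^ 2 +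
        ∑ i, ∑ j, c i j ^ 2 * l j * ‖D i j‖ ^ 2 := by
      rw [hF, Finset.mul_sum, ← Finset.sum_add_distrib]
      refine Finset.sum_congr rfl fun i _ => ?_
      rw [Finset.mul_sum, ← Finset.sum_add_distrib]
      refine Finset.sum_congr rfl fun j _ => ?_
      simp only [hc]
      by_cases h : 0 < l i + l j
      · rw [if_pos h]; field_simp
      · rw [if_neg h]; ring
    linarith

/-- If a state is an average of `U ρ₀ U†` and its derivative is the average of
`U' ρ₀ U† + U ρ₀ U'†`, then its quantum Fisher information is at most four times the average of
`tr (U' ρ₀ U'†)`. -/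
lemma qfi_le_of_average (ρ : ℝ → Matrix n n ℂ) (b : ℝ) {U U' : Ω → Matrix n n ℂ}
    {ρ₀ : Matrix n n ℂ} (hρ₀ : ρ₀.PosSemidef)
    (hi : ∀ i j, Integrable (fun x => (U x * ρ₀ * (U x).conjTranspose) i j) P)
    (hi' : ∀ i j, Integrable (fun x => (U' x * ρ₀ * (U x).conjTranspose +
      U x * ρ₀ * (U' x).conjTranspose) i j) P)
    (hi'' : Integrable (fun x => (U' x * ρ₀ * (U' x).conjTranspose).trace.re) P)
    (hρ : ∀ i j, ρ b i j = ∫ x, (U x * ρ₀ * (U x).conjTranspose) i j ∂P)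
    (hD : ∀ i j, matDeriv ρ b i j = ∫ x, (U' x * ρ₀ * (U x).conjTranspose +
      U x * ρ₀ * (U' x).conjTranspose) i j ∂P) :
    qfi ρ b ≤ 4 * ∫ x, (U' x * ρ₀ * (U' x).conjTranspose).trace.re ∂P := by
  have hherm : ∀ {R : Matrix n n ℂ} {M : Ω → Matrix n n ℂ}, (∀ x, (M x).IsHermitian) →
      (∀ i j, R i j = ∫ x, M x i j ∂P) → R.IsHermitian := by
    intro R M hM hR
    ext i j
    rw [Matrix.conjTranspose_apply, hR, hR, Complex.star_def, ← integral_conj]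
    refine integral_congr_ae (Filter.Eventually.of_forall fun x => ?_)
    exact (hM x).apply i j
  have hρ₀h := hρ₀.isHermitian.eq
  have hρh : (ρ b).IsHermitian := hherm (fun x => (hρ₀.mul_mul_conjTranspose_same _).isHermitian) hρ
  have hDh : (matDeriv ρ b).IsHermitian := hherm (fun x => by
    rw [Matrix.IsHermitian]
    simp only [Matrix.conjTranspose_add, Matrix.conjTranspose_mul,
      Matrix.conjTranspose_conjTranspose, hρ₀h, mul_assoc]
    rw [add_comm]) hD
  obtain ⟨L, hL, hL1, hL2⟩ := exists_symmetric_logarithmic_derivative ρ b hρh hDh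
  obtain ⟨j1, e1⟩ := integral_trace_mul (L * L) hi hρ
  obtain ⟨j2, e2⟩ := integral_trace_mul L hi' hD
  rw [hL2] at e1
  rw [hL1] at e2
  have f1 : ∫ x, (L * L * (U x * ρ₀ * (U x).conjTranspose)).trace.re ∂P = qfi ρ b := by
    have := integral_re j1
    simpa [e1] using this
  have f2 : ∫ x, (L * (U' x * ρ₀ * (U x).conjTranspose +
      U x * ρ₀ * (U' x).conjTranspose)).trace.re ∂P = qfi ρ b := by
    have := integral_re j2
    simpa [e2] using this
  -- This is the trace of `(L U - 2 U') ρ₀ (L U - 2 U')†`. With `L` the symmetric logarithmic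
  -- derivative, its average is `F - 2 F` plus four times the average of `tr (U' ρ₀ U'†)`.
  have hpt : ∀ x, 0 ≤ (L * L * (U x * ρ₀ * (U x).conjTranspose)).trace.re -
      2 * (L * (U' x * ρ₀ * (U x).conjTranspose + U x * ρ₀ * (U' x).conjTranspose)).trace.re +
      4 * (U' x * ρ₀ * (U' x).conjTranspose).trace.re := by
    intro x
    have hp := (Complex.nonneg_iff.1
      (hρ₀.mul_mul_conjTranspose_same (L * U x - (2 : ℂ) • U' x)).trace_nonneg).1
    have e : ((L * U x - (2 : ℂ) • U' x) * ρ₀ * (L * U x - (2 : ℂ) • U' x).conjTranspose).trace =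
        (L * L * (U x * ρ₀ * (U x).conjTranspose)).trace -
        2 * (L * (U' x * ρ₀ * (U x).conjTranspose + U x * ρ₀ * (U' x).conjTranspose)).trace +
        4 * (U' x * ρ₀ * (U' x).conjTranspose).trace := by
      have a1 : (L * L * (U x * ρ₀ * (U x).conjTranspose)).trace =
          (L * U x * ρ₀ * (U x).conjTranspose * L).trace := by
        rw [Matrix.trace_mul_comm _ L]; simp only [mul_assoc]
      have a2 : (L * (U' x * ρ₀ * (U x).conjTranspose)).trace =
          (U' x * ρ₀ * (U x).conjTranspose * L).trace := Matrix.trace_mul_comm _ _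
      rw [a1, mul_add, Matrix.trace_add, a2]
      simp only [Matrix.conjTranspose_sub, Matrix.conjTranspose_mul, Matrix.conjTranspose_smul,
        hL.eq, sub_mul, mul_sub, Matrix.trace_sub, smul_mul_assoc, mul_smul_comm,
        Matrix.trace_smul, smul_eq_mul, mul_assoc]
      simp
      ring
    rw [e] at hp
    simpa using hp
  have hint : 0 ≤ ∫ x, ((L * L * (U x * ρ₀ * (U x).conjTranspose)).trace.re -
      2 * (L * (U' x * ρ₀ * (U x).conjTranspose + U x * ρ₀ * (U' x).conjTranspose)).trace.re +
      4 * (U' x * ρ₀ * (U' x).conjTranspose).trace.re) ∂P := integral_nonneg hpt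
  rw [integral_add (by exact (j1.re.sub (j2.re.const_mul 2))) (hi''.const_mul 4),
    integral_sub (by exact j1.re) (by exact j2.re.const_mul 2), integral_const_mul,
    integral_const_mul, f1, f2] at hint
  linarith

end

end CollectiveDephasing

namespace CollectiveDephasing

/-! ## Trigonometric polynomials in the phases -/

/-- The character `φ ↦ exp (i u·φ)`. -/
noncomputable def phaseChar {n : ℕ} (u φ : Fin n → ℝ) : ℂ :=
  Complex.exp (Complex.I * ((∑ j, u j * φ j : ℝ) : ℂ))

/-- Trigonometric polynomials in `n` phases. -/
noncomputable def trigPoly (n : ℕ) : Submodule ℂ ((Fin n → ℝ) → ℂ) :=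
  Submodule.span ℂ (Set.range phaseChar)

lemma phaseChar_mem {n : ℕ} (u : Fin n → ℝ) : phaseChar u ∈ trigPoly n :=
  Submodule.subset_span ⟨u, rfl⟩

lemma phaseChar_add {n : ℕ} (u v φ : Fin n → ℝ) :
    phaseChar (u + v) φ = phaseChar u φ * phaseChar v φ := by
  simp only [phaseChar, Pi.add_apply, add_mul, Finset.sum_add_distrib]
  rw [← Complex.exp_add]; push_cast; ring_nf

lemma phaseChar_zero {n : ℕ} (φ : Fin n → ℝ) : phaseChar 0 φ = 1 := by simp [phaseChar]

lemma norm_phaseChar {n : ℕ} (u φ : Fin n → ℝ) : ‖phaseChar u φ‖ = 1 := by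
  rw [phaseChar, mul_comm, Complex.norm_exp_ofReal_mul_I]

lemma continuous_phaseChar {n : ℕ} (u : Fin n → ℝ) : Continuous (phaseChar u) := by
  unfold phaseChar; fun_prop

lemma const_mem_trigPoly {n : ℕ} (a : ℂ) : (fun _ => a) ∈ trigPoly n := by
  have := (trigPoly n).smul_mem a (phaseChar_mem 0)
  convert this using 1
  ext φ; simp [phaseChar_zero]

lemma mul_mem_trigPoly {n : ℕ} {f g : (Fin n → ℝ) → ℂ} (hf : f ∈ trigPoly n)
    (hg : g ∈ trigPoly n) : (fun φ => f φ * g φ) ∈ trigPoly n := by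
  refine Submodule.span_induction₂ (p := fun f g _ _ => (fun φ => f φ * g φ) ∈ trigPoly n)
    ?_ ?_ ?_ ?_ ?_ ?_ ?_ hf hg
  · rintro _ _ ⟨u, rfl⟩ ⟨v, rfl⟩
    have := phaseChar_mem (u + v)
    convert this using 1
    ext φ; rw [phaseChar_add]
  · intro y _; simp only [Pi.zero_apply, zero_mul]; exact const_mem_trigPoly 0
  · intro x _; simp only [Pi.zero_apply, mul_zero]; exact const_mem_trigPoly 0
  · intro x y z _ _ _ h1 h2
    simp only [Pi.add_apply, add_mul]; exact (trigPoly n).add_mem h1 h2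
  · intro x y z _ _ _ h1 h2
    simp only [Pi.add_apply, mul_add]; exact (trigPoly n).add_mem h1 h2
  · intro r x y _ _ h
    simp only [Pi.smul_apply, smul_mul_assoc]; exact (trigPoly n).smul_mem r h
  · intro r x y _ _ h
    simp only [Pi.smul_apply, mul_smul_comm]; exact (trigPoly n).smul_mem r h

lemma star_mem_trigPoly {n : ℕ} {f : (Fin n → ℝ) → ℂ} (hf : f ∈ trigPoly n) :
    (fun φ => star (f φ)) ∈ trigPoly n := by
  induction hf using Submodule.span_induction with
  | mem f hf =>
    obtain ⟨u, rfl⟩ := hf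
    have := phaseChar_mem (-u)
    convert this using 1
    ext φ
    simp only [phaseChar, Complex.star_def, ← Complex.exp_conj, map_mul, Complex.conj_I,
      Complex.conj_ofReal, Pi.neg_apply, neg_mul, Finset.sum_neg_distrib, Complex.ofReal_neg,
      mul_neg]
  | zero => simp only [Pi.zero_apply, star_zero]; exact const_mem_trigPoly 0
  | add f g _ _ h1 h2 => simp only [Pi.add_apply, star_add]; exact (trigPoly n).add_mem h1 h2
  | smul a f _ h =>
    simp only [Pi.smul_apply, star_smul]; exact (trigPoly n).smul_mem (star a) h

lemma sum_mem_trigPoly {n : ℕ} {ι : Type*} (s : Finset ι) {f : ι → (Fin n → ℝ) → ℂ}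
    (hf : ∀ i ∈ s, f i ∈ trigPoly n) : (fun φ => ∑ i ∈ s, f i φ) ∈ trigPoly n := by
  have := (trigPoly n).sum_mem hf
  convert this using 1
  ext φ; simp

lemma comp_castSucc_mem_trigPoly {n : ℕ} {f : (Fin n → ℝ) → ℂ} (hf : f ∈ trigPoly n) :
    (fun φ : Fin (n + 1) → ℝ => f fun j => φ j.castSucc) ∈ trigPoly (n + 1) := by
  induction hf using Submodule.span_induction with
  | mem f hf =>
    obtain ⟨u, rfl⟩ := hf
    have := phaseChar_mem (Fin.snoc u 0 : Fin (n + 1) → ℝ)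
    convert this using 1
    ext φ
    simp [phaseChar, Fin.sum_univ_castSucc]
  | zero => simp only [Pi.zero_apply]; exact const_mem_trigPoly 0
  | add f g _ _ h1 h2 => simp only [Pi.add_apply]; exact (trigPoly (n + 1)).add_mem h1 h2
  | smul a f _ h => simp only [Pi.smul_apply]; exact (trigPoly (n + 1)).smul_mem a h

lemma continuous_of_mem_trigPoly {n : ℕ} {f : (Fin n → ℝ) → ℂ} (hf : f ∈ trigPoly n) :
    Continuous f := by
  induction hf using Submodule.span_induction with
  | mem f hf => obtain ⟨u, rfl⟩ := hf; exact continuous_phaseChar u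
  | zero => exact continuous_const
  | add f g _ _ h1 h2 => exact h1.add h2
  | smul a f _ h => exact h.const_smul a

lemma exists_bound_of_mem_trigPoly {n : ℕ} {f : (Fin n → ℝ) → ℂ} (hf : f ∈ trigPoly n) :
    ∃ C, ∀ φ, ‖f φ‖ ≤ C := by
  induction hf using Submodule.span_induction with
  | mem f hf => obtain ⟨u, rfl⟩ := hf; exact ⟨1, fun φ => (norm_phaseChar u φ).le⟩
  | zero => exact ⟨0, by simp⟩
  | add f g _ _ h1 h2 =>
    obtain ⟨C, hC⟩ := h1
    obtain ⟨D, hD⟩ := h2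
    exact ⟨C + D, fun φ => (norm_add_le _ _).trans (add_le_add (hC φ) (hD φ))⟩
  | smul a f _ h =>
    obtain ⟨C, hC⟩ := h
    refine ⟨‖a‖ * C, fun φ => ?_⟩
    rw [Pi.smul_apply, norm_smul]
    exact mul_le_mul_of_nonneg_left (hC φ) (norm_nonneg _)

/-! ### Averages of trigonometric polynomials over random phases -/

section Average

variable {Ω : Type*} [MeasurableSpace Ω] {P : Measure Ω} {n : ℕ} {X : Ω → Fin n → ℝ}

lemma integrable_mul_trigPoly {W : Ω → ℂ} (hW : Integrable W P) (hX : Measurable X)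
    {f : (Fin n → ℝ) → ℂ} (hf : f ∈ trigPoly n) : Integrable (fun x => W x * f (X x)) P := by
  obtain ⟨C, hC⟩ := exists_bound_of_mem_trigPoly hf
  exact hW.mul_bdd (c := C) ((continuous_of_mem_trigPoly hf).measurable.comp hX).aestronglyMeasurable
    (Filter.Eventually.of_forall fun x => hC _)

lemma integrable_trigPoly [IsProbabilityMeasure P] (hX : Measurable X)
    {f : (Fin n → ℝ) → ℂ} (hf : f ∈ trigPoly n) : Integrable (fun x => f (X x)) P := by
  simpa using integrable_mul_trigPoly (integrable_const (1 : ℂ)) hX hf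

/-- Averages of trigonometric polynomials of the phases are differentiable along the signal; the
derivative is the average of the pointwise derivative, and also the correlation with a score. -/
lemma exists_deriv_of_mem_trigPoly [IsProbabilityMeasure P] (hX : Measurable X) {W : Ω → ℝ}
    (hW : Integrable W P) (Δ : Fin n → ℝ)
    (hscore : ∀ u : Fin n → ℝ, ∫ x, (W x : ℂ) * phaseChar u (X x) ∂P =
      Complex.I * ((∑ j, u j * Δ j : ℝ) : ℂ) * ∫ x, phaseChar u (X x) ∂P)
    {f : (Fin n → ℝ) → ℂ} (hf : f ∈ trigPoly n) :
    ∃ g ∈ trigPoly n,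
      (∀ φ (b : ℝ), HasDerivAt (fun b : ℝ => f (b • Δ + φ)) (g (b • Δ + φ)) b) ∧
      ∀ b : ℝ, HasDerivAt (fun b : ℝ => ∫ x, f (b • Δ + X x) ∂P) (∫ x, g (b • Δ + X x) ∂P) b ∧
        ∫ x, (W x : ℂ) * f (b • Δ + X x) ∂P = ∫ x, g (b • Δ + X x) ∂P := by
  have hXb : ∀ b : ℝ, Measurable fun x => b • Δ + X x := fun b => hX.const_add _
  have hWc : Integrable (fun x => (W x : ℂ)) P := hW.ofReal
  induction hf using Submodule.span_induction with
  | mem f hf =>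
    obtain ⟨u, rfl⟩ := hf
    set a : ℝ := ∑ j, u j * Δ j with ha
    -- The signal multiplies a character by a scalar that leaves the integral, so nothing is
    -- differentiated under the integral sign. The other cases are linearity.
    have hshift : ∀ (b : ℝ) (φ : Fin n → ℝ), phaseChar u (b • Δ + φ) =
        Complex.exp (Complex.I * a * b) * phaseChar u φ := by
      intro b φ
      have : ∑ j, u j * (b • Δ + φ) j = a * b + ∑ j, u j * φ j := by
        rw [ha, Finset.sum_mul, ← Finset.sum_add_distrib]
        refine Finset.sum_congr rfl fun j _ => ?_
        simp only [Pi.add_apply, Pi.smul_apply, smul_eq_mul]; ring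
      simp only [phaseChar]
      rw [this, ← Complex.exp_add]; push_cast; ring_nf
    have hE : ∀ b : ℝ, HasDerivAt (fun b : ℝ => Complex.exp (Complex.I * a * b))
        (Complex.exp (Complex.I * a * b) * (Complex.I * a)) b := by
      intro b
      have := ((hasDerivAt_id b).ofReal_comp.const_mul (Complex.I * (a : ℂ))).cexp
      simpa using this
    refine ⟨(Complex.I * a) • phaseChar u, (trigPoly n).smul_mem _ (phaseChar_mem u),
      fun φ b => ?_, fun b => ⟨?_, ?_⟩⟩
    · simp only [Pi.smul_apply, smul_eq_mul, hshift]
      refine ((hE b).mul_const (phaseChar u φ)).congr_deriv (by ring)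
    · simp only [Pi.smul_apply, smul_eq_mul, hshift, integral_const_mul]
      refine ((hE b).mul_const (∫ x, phaseChar u (X x) ∂P)).congr_deriv (by ring)
    · simp only [Pi.smul_apply, smul_eq_mul, hshift, integral_const_mul, mul_left_comm (Complex.ofReal _),
        hscore]
      ring
  | zero =>
    refine ⟨0, (trigPoly n).zero_mem, fun φ b => ?_, fun b => ⟨?_, ?_⟩⟩
    · exact hasDerivAt_const _ _
    · simpa using hasDerivAt_const b (0 : ℂ)
    · simp
  | add f g hf hg h1 h2 =>
    obtain ⟨f', hf', hf1, hf2⟩ := h1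
    obtain ⟨g', hg', hg1, hg2⟩ := h2
    refine ⟨f' + g', (trigPoly n).add_mem hf' hg', fun φ b => (hf1 φ b).add (hg1 φ b),
      fun b => ⟨?_, ?_⟩⟩
    · have e : (fun b : ℝ => ∫ x, (f + g) (b • Δ + X x) ∂P) =
          (fun b : ℝ => ∫ x, f (b • Δ + X x) ∂P) + fun b : ℝ => ∫ x, g (b • Δ + X x) ∂P := by
        ext b
        exact integral_add (integrable_trigPoly (hXb b) hf) (integrable_trigPoly (hXb b) hg)
      rw [e]
      refine ((hf2 b).1.add (hg2 b).1).congr_deriv ?_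
      exact (integral_add (integrable_trigPoly (hXb b) hf') (integrable_trigPoly (hXb b) hg')).symm
    · simp only [Pi.add_apply, mul_add]
      have e1 := integral_add (integrable_mul_trigPoly hWc (hXb b) hf)
        (integrable_mul_trigPoly hWc (hXb b) hg)
      have e2 := integral_add (integrable_trigPoly (P := P) (hXb b) hf')
        (integrable_trigPoly (hXb b) hg')
      rw [e1, e2, (hf2 b).2, (hg2 b).2]
  | smul a f hf h =>
    obtain ⟨f', hf', hf1, hf2⟩ := h
    refine ⟨a • f', (trigPoly n).smul_mem a hf', fun φ b => (hf1 φ b).const_smul a,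
      fun b => ⟨?_, ?_⟩⟩
    · simp only [Pi.smul_apply, integral_smul]
      exact (hf2 b).1.const_smul a
    · simp only [Pi.smul_apply, mul_smul_comm, integral_smul, (hf2 b).2]

end Average

/-! ## The propagator -/

/-- Eigenvalues of `J_z` in the computational basis. -/
noncomputable def zEigenvalue {N : ℕ} (x : Idx N) : ℝ :=
  1 / 2 * ∑ k, if x k = 0 then 1 else -1

lemma abs_zEigenvalue_le {N : ℕ} (x : Idx N) : |zEigenvalue x| ≤ N / 2 := by
  rw [zEigenvalue, abs_mul, abs_of_pos (by norm_num : (0 : ℝ) < 1 / 2)]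
  have : |∑ k, if x k = 0 then (1 : ℝ) else -1| ≤ ∑ _k : Fin N, (1 : ℝ) := by
    refine (Finset.abs_sum_le_sum_abs _ _).trans (Finset.sum_le_sum fun k _ => ?_)
    split_ifs <;> simp
  simp only [Finset.sum_const, Finset.card_univ, Fintype.card_fin, nsmul_eq_mul, mul_one] at this
  linarith

lemma Jz_eq_diagonal (N : ℕ) : Jz N = Matrix.diagonal fun x => (zEigenvalue x : ℂ) := by
  ext x y
  rw [Jz, collective, Matrix.smul_apply, Matrix.sum_apply]
  by_cases h : x = y
  · subst h
    rw [Matrix.diagonal_apply_eq, zEigenvalue, smul_eq_mul]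
    push_cast
    congr 1
    refine Finset.sum_congr rfl fun k _ => ?_
    simp only [onSite, Matrix.of_apply, implies_true, if_true, pauliZ]
    generalize x k = a
    fin_cases a <;> simp
  · rw [Matrix.diagonal_apply_ne _ h, Finset.sum_eq_zero, smul_zero]
    intro k _
    simp only [onSite, Matrix.of_apply]
    split_ifs with hk
    · have hne : x k ≠ y k := fun he => h (funext fun l => by
        by_cases hl : l = k
        · rw [hl, he]
        · exact hk l hl)
      generalize x k = a at hne
      generalize y k = c at hne
      fin_cases a <;> fin_cases c <;> simp_all [pauliZ]
    · rfl

lemma unitaryExp_Jz {N : ℕ} (θ : ℝ) :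
    unitaryExp θ (Jz N) =
      Matrix.diagonal fun x => Complex.exp (Complex.I * ((-(zEigenvalue x) * θ : ℝ) : ℂ)) := by
  rw [unitaryExp, Jz_eq_diagonal, ← Matrix.diagonal_smul, Matrix.exp_diagonal]
  congr 1
  ext x
  rw [Pi.coe_exp, ← Complex.exp_eq_exp_ℂ]
  congr 1
  simp only [Pi.smul_apply, smul_eq_mul]
  push_cast; ring

open scoped Matrix.Norms.L2Operator

lemma unitaryExp_mem_unitary {N : ℕ} (θ : ℝ) {A : Op N} (hA : A.IsHermitian) :
    unitaryExp θ A ∈ unitary (Op N) := by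
  let _ : NormedAlgebra ℚ (Op N) := .restrictScalars ℚ ℂ (Op N)
  refine NormedSpace.exp_mem_unitary_of_mem_skewAdjoint ?_
  rw [skewAdjoint.mem_iff, star_smul, Matrix.star_eq_conjTranspose, hA.eq, ← neg_smul]
  congr 1
  simp

lemma propagator_mem_unitary {N : ℕ} : ∀ (Q : ℕ) (V : Fin Q → Op N)
    (_ : ∀ k, V k ∈ unitary (Op N)) (φ : Fin (Q + 1) → ℝ), propagator Q V φ ∈ unitary (Op N) := by
  have hJ : (Jz N).IsHermitian := by
    rw [Jz_eq_diagonal]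
    exact Matrix.isHermitian_diagonal_of_self_adjoint _ (funext fun x => by simp)
  intro Q
  induction Q with
  | zero => exact fun V _ φ => unitaryExp_mem_unitary _ hJ
  | succ Q ih =>
    exact fun V hV φ => mul_mem (mul_mem (unitaryExp_mem_unitary _ hJ) (hV _)) (ih _ (fun k => hV _) _)

/-- Free precession is diagonal with characters as entries, and the pulses do not depend on the
phases. Hence noise averages of the evolution reduce to characteristic functions. -/
lemma propagator_mem_trigPoly {N : ℕ} (Q : ℕ) (V : Fin Q → Op N) (i j : Idx N) :
    (fun φ => propagator Q V φ i j) ∈ trigPoly (Q + 1) := by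
  have hdiag : ∀ (n : ℕ) (l : Fin n) (i j : Idx N),
      (fun φ : Fin n → ℝ => unitaryExp (φ l) (Jz N) i j) ∈ trigPoly n := by
    intro n l i j
    simp only [unitaryExp_Jz]
    by_cases h : i = j
    · subst h
      simp only [Matrix.diagonal_apply_eq]
      convert phaseChar_mem (Pi.single l (-zEigenvalue i)) using 1
      ext φ
      simp [phaseChar, Pi.single_apply]
    · simp only [Matrix.diagonal_apply_ne _ h]
      exact const_mem_trigPoly 0
  induction Q generalizing i j with
  | zero => exact hdiag _ _ _ _
  | succ Q ih =>
    simp only [propagator, Matrix.mul_apply]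
    refine sum_mem_trigPoly _ fun k _ => mul_mem_trigPoly (sum_mem_trigPoly _ fun l _ =>
      mul_mem_trigPoly (hdiag _ _ _ _) (const_mem_trigPoly _)) ?_
    exact comp_castSucc_mem_trigPoly (ih (fun k => V k.castSucc) k j)

lemma norm_le_one_of_mem_unitary {N : ℕ} {U : Op N} (hU : U ∈ unitary (Op N)) : ‖U‖ ≤ 1 :=
  (CStarRing.norm_of_mem_unitary hU).le

/-- The propagator is differentiable along the signal, with derivative bounded by the total
precession generated by `J_z`. -/
lemma exists_hasDerivAt_propagator {N : ℕ} (Q : ℕ) (V : Fin Q → Op N)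
    (hV : ∀ k, V k ∈ unitary (Op N)) (Δ φ : Fin (Q + 1) → ℝ) (hΔ : ∀ j, 0 ≤ Δ j) (b : ℝ) :
    ∃ U' : Op N, HasDerivAt (fun b : ℝ => propagator Q V (b • Δ + φ)) U' b ∧
      ‖U'‖ ≤ N / 2 * ∑ j, Δ j := by
  have hdiag : ∀ d p : ℝ, 0 ≤ d → ∃ U' : Op N,
      HasDerivAt (fun b : ℝ => unitaryExp (b * d + p) (Jz N)) U' b ∧ ‖U'‖ ≤ N / 2 * d := by
    intro d p hd
    have hderiv : ∀ x : Idx N, HasDerivAt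
        (fun b : ℝ => Complex.exp (Complex.I * ((-(zEigenvalue x) * (b * d + p) : ℝ) : ℂ)))
        (Complex.exp (Complex.I * ((-(zEigenvalue x) * (b * d + p) : ℝ) : ℂ)) *
          (Complex.I * ((-(zEigenvalue x) * d : ℝ) : ℂ))) b := by
      intro x
      have h1 : HasDerivAt (fun b : ℝ => -(zEigenvalue x) * (b * d + p)) (-(zEigenvalue x) * d) b := by
        simpa using (((hasDerivAt_id b).mul_const d).add_const p).const_mul (-(zEigenvalue x))
      exact (h1.ofReal_comp.const_mul Complex.I).cexp
    refine ⟨Matrix.diagonal fun x =>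
        Complex.exp (Complex.I * ((-(zEigenvalue x) * (b * d + p) : ℝ) : ℂ)) *
          (Complex.I * ((-(zEigenvalue x) * d : ℝ) : ℂ)), ?_, ?_⟩
    · simp only [unitaryExp_Jz]
      refine hasDerivAt_pi.2 fun i => hasDerivAt_pi.2 fun j => ?_
      by_cases h : i = j
      · subst h
        simpa only [Matrix.diagonal_apply_eq] using hderiv i
      · simpa only [Matrix.diagonal_apply_ne _ h] using hasDerivAt_const b (0 : ℂ)
    · rw [Matrix.l2_opNorm_diagonal, pi_norm_le_iff_of_nonneg (by positivity)]
      intro x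
      rw [norm_mul, mul_comm Complex.I, Complex.norm_exp_ofReal_mul_I, one_mul, norm_mul,
        Complex.norm_I, one_mul, Complex.norm_real, Real.norm_eq_abs, abs_mul, abs_neg,
        abs_of_nonneg hd]
      exact mul_le_mul_of_nonneg_right (abs_zEigenvalue_le x) hd
  induction Q with
  | zero =>
    obtain ⟨U', h1, h2⟩ := hdiag (Δ 0) (φ 0) (hΔ 0)
    exact ⟨U', h1, by simpa using h2⟩
  | succ Q ih =>
    obtain ⟨A', h1, h2⟩ := hdiag (Δ (Fin.last _)) (φ (Fin.last _)) (hΔ _)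
    obtain ⟨B', h3, h4⟩ := ih (fun k => V k.castSucc) (fun k => hV _) (fun j => Δ j.castSucc)
      (fun j => φ j.castSucc) (fun j => hΔ _)
    have hJ : (Jz N).IsHermitian := by
      rw [Jz_eq_diagonal]
      exact Matrix.isHermitian_diagonal_of_self_adjoint _ (funext fun x => by simp)
    -- In the product rule every undifferentiated factor has norm at most `1`, so the contributions
    -- `N / 2 * Δ j` of the segments simply add.
    refine ⟨_, (h1.mul_const (V (Fin.last Q))).mul h3, ?_⟩
    have n1 := norm_le_one_of_mem_unitary (hV (Fin.last Q))
    have n2 := norm_le_one_of_mem_unitary (propagator_mem_unitary Q (fun k => V k.castSucc)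
      (fun k => hV _) (b • (fun j => Δ j.castSucc) + fun j => φ j.castSucc))
    have n3 := norm_le_one_of_mem_unitary
      (unitaryExp_mem_unitary (b * Δ (Fin.last _) + φ (Fin.last _)) hJ)
    rw [Fin.sum_univ_castSucc, mul_add, add_comm (N / 2 * ∑ j : Fin (Q + 1), Δ j.castSucc)]
    refine (norm_add_le _ _).trans (add_le_add ?_ ?_)
    · refine (norm_mul_le _ _).trans ((mul_le_of_le_one_right (norm_nonneg _) n2).trans ?_)
      exact (norm_mul_le _ _).trans ((mul_le_of_le_one_right (norm_nonneg _) n1).trans h2)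
    · refine (norm_mul_le _ _).trans ((mul_le_of_le_one_left (norm_nonneg _) ?_).trans h4)
      exact (norm_mul_le _ _).trans (mul_le_one₀ n3 (norm_nonneg _) n1)

-- With `ρ = B† B`, the left side is the sum of the squared lengths of the columns of `A B†`, and
-- `A` stretches each column of `B†` by at most its operator norm.
open scoped MatrixOrder in
lemma trace_mul_mul_conjTranspose_le {n : Type*} [Fintype n] [DecidableEq n] (A : Matrix n n ℂ)
    {ρ : Matrix n n ℂ} (hρ : ρ.PosSemidef) :
    (A * ρ * A.conjTranspose).trace.re ≤ ‖A‖ ^ 2 * ρ.trace.re := by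
  obtain ⟨B, hB⟩ := CStarAlgebra.nonneg_iff_eq_star_mul_self.1 hρ.nonneg
  rw [Matrix.star_eq_conjTranspose] at hB
  have key : ∀ C : Matrix n n ℂ, (C * C.conjTranspose).trace.re = ∑ j, ∑ i, ‖C i j‖ ^ 2 := by
    intro C
    simp only [Matrix.trace, Matrix.diag, Matrix.mul_apply, Matrix.conjTranspose_apply,
      Complex.re_sum]
    rw [Finset.sum_comm]
    refine Finset.sum_congr rfl fun i _ => Finset.sum_congr rfl fun j _ => ?_
    rw [Complex.star_def, Complex.mul_conj, Complex.normSq_eq_norm_sq, Complex.ofReal_re]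
  have e1 : A * ρ * A.conjTranspose = (A * B.conjTranspose) * (A * B.conjTranspose).conjTranspose := by
    rw [hB, Matrix.conjTranspose_mul, Matrix.conjTranspose_conjTranspose]; simp only [mul_assoc]
  have e2 : ρ = B.conjTranspose * B.conjTranspose.conjTranspose := by
    rw [Matrix.conjTranspose_conjTranspose, hB]
  rw [e1, key]
  conv_rhs => rw [e2, key]
  rw [Finset.mul_sum]
  refine Finset.sum_le_sum fun j _ => ?_
  have := Matrix.l2_opNorm_mulVec A (WithLp.toLp 2 fun i => B.conjTranspose i j)
  have h2 := pow_le_pow_left₀ (norm_nonneg _) this 2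
  rw [mul_pow, EuclideanSpace.norm_sq_eq, EuclideanSpace.norm_sq_eq] at h2
  exact h2

end CollectiveDephasing

namespace CollectiveDephasing

/-! ## Output states and the two bounds on their quantum Fisher information -/

section

variable {Ω : Type*} [MeasurableSpace Ω] {P : Measure Ω}

/-- An average of density matrices is a density matrix. -/
lemma isDensity_of_average [IsProbabilityMeasure P] {n : Type*} [Fintype n] [DecidableEq n]
    {M : Ω → Matrix n n ℂ} {R : Matrix n n ℂ} (hM : ∀ x, IsDensity (M x))
    (hi : ∀ i j, Integrable (fun x => M x i j) P) (hR : ∀ i j, R i j = ∫ x, M x i j ∂P) :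
    IsDensity R := by
  refine ⟨Matrix.PosSemidef.of_dotProduct_mulVec_nonneg ?_ fun v => ?_, ?_⟩
  · ext i j
    rw [Matrix.conjTranspose_apply, hR, hR, Complex.star_def, ← integral_conj]
    refine integral_congr_ae (Filter.Eventually.of_forall fun x => ?_)
    exact (hM x).1.isHermitian.apply i j
  · have htr : ∀ A : Matrix n n ℂ,
        star v ⬝ᵥ A.mulVec v = (Matrix.vecMulVec v (star v) * A).trace := fun A => by
      rw [Matrix.vecMulVec_mul, Matrix.trace_vecMulVec, dotProduct_comm v,
        Matrix.dotProduct_mulVec]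
    rw [htr, ← (integral_trace_mul _ hi hR).2]
    have hre : ∀ x, (Matrix.vecMulVec v (star v) * M x).trace =
        (((Matrix.vecMulVec v (star v) * M x).trace.re : ℝ) : ℂ) ∧
        0 ≤ (Matrix.vecMulVec v (star v) * M x).trace.re := fun x => by
      have h := (hM x).1.dotProduct_mulVec_nonneg v
      rw [htr] at h
      have h' := Complex.nonneg_iff.1 h
      exact ⟨Complex.ext (by simp) (by simp [← h'.2]), h'.1⟩
    rw [integral_congr_ae (Filter.Eventually.of_forall fun x => (hre x).1), integral_complex_ofReal]
    exact Complex.zero_le_real.2 (integral_nonneg fun x => (hre x).2)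
  · have := (integral_trace_mul (1 : Matrix n n ℂ) hi hR).2
    simp only [one_mul] at this
    rw [← this]
    simp [(hM _).2]

lemma IsDensity.conj_unitary {n : Type*} [Fintype n] [DecidableEq n] {ρ U : Matrix n n ℂ}
    (hρ : IsDensity ρ) (hU : U ∈ unitary (Matrix n n ℂ)) : IsDensity (U * ρ * U.conjTranspose) := by
  refine ⟨hρ.1.mul_mul_conjTranspose_same U, ?_⟩
  have h : U.conjTranspose * U = 1 := (Unitary.mem_iff.1 hU).1
  rw [mul_assoc, Matrix.trace_mul_comm, mul_assoc, h, mul_one, hρ.2]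

/-- Integrals of the noise over the segments. -/
noncomputable def segmentNoise {N Q : ℕ} (c : PulseSequence N Q) (ξ : ℝ → Ω → ℝ) (x : Ω)
    (j : Fin (Q + 1)) : ℝ :=
  ∫ s in (c.time j.castSucc)..(c.time j.succ), ξ s x

/-- Durations of the segments. -/
noncomputable def PulseSequence.step {N Q : ℕ} (c : PulseSequence N Q) (j : Fin (Q + 1)) : ℝ :=
  c.time j.succ - c.time j.castSucc

lemma PulseSequence.step_nonneg {N Q : ℕ} (c : PulseSequence N Q) (j : Fin (Q + 1)) :
    0 ≤ c.step j :=
  sub_nonneg.2 (c.time_strictMono.monotone (Fin.castSucc_le_succ j))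

lemma PulseSequence.sum_step {N Q : ℕ} (c : PulseSequence N Q) : ∑ j, c.step j = c.duration := by
  have key : ∀ (n : ℕ) (f : Fin (n + 1) → ℝ),
      ∑ j : Fin n, (f j.succ - f j.castSucc) = f (Fin.last n) - f 0 := by
    intro n f
    induction n with
    | zero => simp
    | succ n ih =>
      rw [Fin.sum_univ_castSucc]
      have := ih (fun j => f j.castSucc)
      simp only [Fin.succ_castSucc, Fin.castSucc_zero] at this ⊢
      rw [this, Fin.succ_last]; ring
  have := key (Q + 1) c.time
  rw [c.time_zero, sub_zero] at this
  exact this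

lemma PulseSequence.duration_pos {N Q : ℕ} (c : PulseSequence N Q) : 0 < c.duration := by
  rw [duration, ← c.time_zero]
  exact c.time_strictMono (Fin.last_pos)

lemma PulseSequence.pulse_mem_unitary {N Q : ℕ} (c : PulseSequence N Q) (k : Fin Q) :
    c.pulse k ∈ unitary (Op N) := unitaryExp_mem_unitary _ (c.gen_hermitian k)

open scoped Matrix.Norms.L2Operator in
set_option maxHeartbeats 1000000 in
/-- Given a score `W` for the signal, the output state is a density matrix, differentiable in the
signal, and its quantum Fisher information is bounded both by the second moment of the score and by
the noiseless value `t² N²`. -/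
lemma outputState_properties [IsProbabilityMeasure P] {N Q : ℕ} (c : PulseSequence N Q)
    {ξ : ℝ → Ω → ℝ} (hX : Measurable (segmentNoise c ξ)) {W : Ω → ℝ} (hWL : MemLp W 2 P)
    (hscore : ∀ u : Fin (Q + 1) → ℝ, ∫ x, (W x : ℂ) * phaseChar u (segmentNoise c ξ x) ∂P =
      Complex.I * ((∑ j, u j * c.step j : ℝ) : ℂ) * ∫ x, phaseChar u (segmentNoise c ξ x) ∂P)
    {ρ₀ : Op N} (hρ₀ : IsDensity ρ₀) (b : ℝ) :
    IsDensity (outputState P c ξ ρ₀ b) ∧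
      (∀ i j, DifferentiableAt ℝ (fun b' => outputState P c ξ ρ₀ b' i j) b) ∧
      qfi (outputState P c ξ ρ₀) b ≤ ∫ x, W x ^ 2 ∂P ∧
      qfi (outputState P c ξ ρ₀) b ≤ (c.duration * N) ^ 2 := by
  set X := segmentNoise c ξ with hXd
  have hW : Integrable W P := hWL.integrable (by norm_num)
  have hXb : Measurable fun x => b • c.step + X x := hX.const_add _
  set u : Idx N → Idx N → (Fin (Q + 1) → ℝ) → ℂ := fun i j φ => propagator Q c.pulse φ i j with hu
  have hum : ∀ i j, u i j ∈ trigPoly (Q + 1) := fun i j => propagator_mem_trigPoly Q c.pulse i j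
  choose g hg hg1 hg2 using fun i j => exists_deriv_of_mem_trigPoly hX hW c.step hscore (hum i j)
  have hsand : ∀ f f' : Idx N → Idx N → (Fin (Q + 1) → ℝ) → ℂ, (∀ i j, f i j ∈ trigPoly (Q + 1)) →
      (∀ i j, f' i j ∈ trigPoly (Q + 1)) → ∀ i j, (fun φ => (Matrix.of (fun k l => f k l φ) * ρ₀ *
        (Matrix.of (fun k l => f' k l φ)).conjTranspose) i j) ∈ trigPoly (Q + 1) := by
    intro f f' hf hf' i j
    simp only [Matrix.mul_apply, Matrix.conjTranspose_apply, Matrix.of_apply]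
    exact sum_mem_trigPoly _ fun k _ => mul_mem_trigPoly (sum_mem_trigPoly _ fun l _ =>
      mul_mem_trigPoly (hf _ _) (const_mem_trigPoly _)) (star_mem_trigPoly (hf' _ _))
  set U : Ω → Op N := fun x => trajectoryUnitary c ξ b x with hU
  set G : (Fin (Q + 1) → ℝ) → Op N := fun φ => Matrix.of fun i j => g i j φ with hG
  set U' : Ω → Op N := fun x => G (b • c.step + X x) with hU'
  have hMm : ∀ i j, (fun φ => (propagator Q c.pulse φ * ρ₀ *
      (propagator Q c.pulse φ).conjTranspose) i j) ∈ trigPoly (Q + 1) := fun i j =>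
    hsand u u hum hum i j
  choose m hm hm1 hm2 using fun i j => exists_deriv_of_mem_trigPoly hX hW c.step hscore (hMm i j)
  have hout : ∀ i j, outputState P c ξ ρ₀ b i j = ∫ x, (U x * ρ₀ * (U x).conjTranspose) i j ∂P :=
    fun i j => rfl
  have hi : ∀ i j, Integrable (fun x => (U x * ρ₀ * (U x).conjTranspose) i j) P := fun i j =>
    integrable_trigPoly hXb (hMm i j)
  have hUu : ∀ x, U x ∈ unitary (Op N) := fun x =>
    propagator_mem_unitary Q c.pulse c.pulse_mem_unitary _
  have hdens : IsDensity (outputState P c ξ ρ₀ b) :=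
    isDensity_of_average (fun x => hρ₀.conj_unitary (hUu x)) hi hout
  have hderiv : ∀ i j, HasDerivAt (fun b' => outputState P c ξ ρ₀ b' i j)
      (∫ x, m i j (b • c.step + X x) ∂P) b := fun i j => (hm2 i j b).1
  have hmat : ∀ i j, matDeriv (outputState P c ξ ρ₀) b i j =
      ∫ x, m i j (b • c.step + X x) ∂P := fun i j => (hderiv i j).deriv
  -- `g` and `m` were chosen separately, as derivatives of the propagator and of the conjugated
  -- state. Uniqueness of derivatives ties them by the product rule.
  have hmU : ∀ i j x, m i j (b • c.step + X x) =
      (U' x * ρ₀ * (U x).conjTranspose + U x * ρ₀ * (U' x).conjTranspose) i j := by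
    intro i j x
    refine (hm1 i j (X x) b).unique ?_
    have h1 : ∀ k l, HasDerivAt (fun b : ℝ => propagator Q c.pulse (b • c.step + X x) k l)
        (U' x k l) b := fun k l => hg1 k l (X x) b
    simp only [Matrix.add_apply, Matrix.mul_apply, Matrix.conjTranspose_apply]
    rw [← Finset.sum_add_distrib]
    refine HasDerivAt.fun_sum fun k _ => ?_
    refine HasDerivAt.mul (HasDerivAt.fun_sum fun l _ => (h1 i l).mul_const _) ?_
    exact (h1 j k).star
  refine ⟨hdens, fun i j => (hderiv i j).differentiableAt, ?_, ?_⟩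
  -- Noise bound: with `U' = (W / 2) U` the symmetrised product is `W U ρ₀ U†`, whose average is
  -- `∂ρ` by the score identity.
  · have hWc : Integrable (fun x => (W x : ℂ)) P := hW.ofReal
    have hWi : ∀ i j, Integrable (fun x => (W x : ℂ) * (U x * ρ₀ * (U x).conjTranspose) i j) P :=
      fun i j => integrable_mul_trigPoly hWc hXb (hMm i j)
    have hWD : ∀ i j, matDeriv (outputState P c ξ ρ₀) b i j =
        ∫ x, (W x : ℂ) * (U x * ρ₀ * (U x).conjTranspose) i j ∂P := fun i j =>
      (hmat i j).trans (hm2 i j b).2.symm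
    have hWU : ∀ x, ((W x / 2 : ℝ) : ℂ) • U x * ρ₀ * (U x).conjTranspose +
        U x * ρ₀ * (((W x / 2 : ℝ) : ℂ) • U x).conjTranspose =
        (W x : ℂ) • (U x * ρ₀ * (U x).conjTranspose) := by
      intro x
      rw [Matrix.conjTranspose_smul, Complex.star_def, Complex.conj_ofReal, smul_mul_assoc,
        smul_mul_assoc, mul_smul_comm, ← add_smul]
      congr 1
      push_cast; ring
    have htr : ∀ x, (((W x / 2 : ℝ) : ℂ) • U x * ρ₀ *
        (((W x / 2 : ℝ) : ℂ) • U x).conjTranspose).trace.re = W x ^ 2 / 4 := by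
      intro x
      rw [Matrix.conjTranspose_smul, Complex.star_def, Complex.conj_ofReal, smul_mul_assoc,
        smul_mul_assoc, mul_smul_comm, smul_smul, Matrix.trace_smul,
        (hρ₀.conj_unitary (hUu x)).2, smul_eq_mul, mul_one, ← Complex.ofReal_mul,
        Complex.ofReal_re]
      ring
    have hq := qfi_le_of_average (P := P) (outputState P c ξ ρ₀) b (U := U)
      (U' := fun x => ((W x / 2 : ℝ) : ℂ) • U x) hρ₀.1 hi
      (fun i j => by
        simp only [hWU, Matrix.smul_apply, smul_eq_mul]
        exact hWi i j)
      (by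
        simp only [htr]
        exact hWL.integrable_sq.div_const 4) hout
      (fun i j => by
        simp only [hWU, Matrix.smul_apply, smul_eq_mul]
        exact hWD i j)
    simp only [htr] at hq
    rw [integral_div] at hq
    linarith
  -- Noiseless bound: here `U'` is the true derivative along each trajectory.
  · have hbound : ∀ x, (U' x * ρ₀ * (U' x).conjTranspose).trace.re ≤ (N / 2 * c.duration) ^ 2 := by
      intro x
      obtain ⟨D, hD1, hD2⟩ := exists_hasDerivAt_propagator Q c.pulse c.pulse_mem_unitary c.step
        (X x) c.step_nonneg b
      have hDU : U' x = D := by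
        ext i j
        exact (hg1 i j (X x) b).unique (hasDerivAt_pi.1 (hasDerivAt_pi.1 hD1 i) j)
      have h1 := trace_mul_mul_conjTranspose_le D hρ₀.1
      rw [hρ₀.2, Complex.one_re, mul_one] at h1
      rw [hDU]
      rw [c.sum_step] at hD2
      exact h1.trans (pow_le_pow_left₀ (norm_nonneg _) hD2 2)
    have hi3 : Integrable (fun x => (U' x * ρ₀ * (U' x).conjTranspose).trace.re) P := by
      have : ∀ i j, Integrable (fun x => (U' x * ρ₀ * (U' x).conjTranspose) i j) P := fun i j =>
        integrable_trigPoly hXb (hsand g g hg hg i j)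
      have h2 := (integral_trace_mul (1 : Op N) this (R := Matrix.of fun i j => ∫ x,
        (U' x * ρ₀ * (U' x).conjTranspose) i j ∂P) fun i j => rfl).1
      simp only [one_mul] at h2
      exact h2.re
    have hq := qfi_le_of_average (P := P) (outputState P c ξ ρ₀) b (U := U) (U' := U') hρ₀.1 hi
      (fun i j => by
        simp only [← hmU]
        exact integrable_trigPoly hXb (hm i j)) hi3 hout
      (fun i j => by simp only [← hmU]; exact hmat i j)
    have h4 := integral_mono hi3 (integrable_const _) hbound
    simp only [integral_const, probReal_univ, one_smul] at h4
    refine hq.trans ?_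
    calc 4 * ∫ x, (U' x * ρ₀ * (U' x).conjTranspose).trace.re ∂P
        ≤ 4 * (N / 2 * c.duration) ^ 2 := by linarith
      _ = (c.duration * N) ^ 2 := by ring

end

end CollectiveDephasing

/-! ### Combination of the two bounds -/

open CollectiveDephasing in
theorem corollary2 (σ : ℝ → ℝ) (hσ : IsSpectralProfile σ) :
    ∃ K : ℕ → ℝ, (∀ n, 0 < K n) ∧
      ∀ (ωc : ℝ), 0 < ωc →
      ∀ (Ω : Type*) [MeasurableSpace Ω] (P : MeasureTheory.Measure Ω)
        [MeasureTheory.IsProbabilityMeasure P] (ξ : ℝ → Ω → ℝ),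
        IsStationaryGaussianNoise P ξ (noiseSpectrum σ ωc) →
      ∀ (N Q : ℕ), 1 ≤ N →
      ∀ (c : PulseSequence N Q), ωc * c.duration ≤ 1 →
      ∀ (ρ₀ : Op N), IsDensity ρ₀ →
      ∀ (T : ℝ), 0 < T →
      ∀ (b : ℝ),
        IsDensity (outputState P c ξ ρ₀ b) ∧
        (∀ i j, DifferentiableAt ℝ (fun b' => outputState P c ξ ρ₀ b' i j) b) ∧
        totalQFI T c.duration (outputState P c ξ ρ₀) b ≤ T / ωc * Real.sqrt (K (Q + 1)) * N ∧
        ENNReal.ofReal (ωc / T * (Real.sqrt (K (Q + 1)))⁻¹ * (N : ℝ)⁻¹) ≤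
          qcrb T c.duration (outputState P c ξ ρ₀) b := by
  choose K hK H using fun n => hσ.exists_score n
  refine ⟨K, hK, fun ωc hωc Ω _ P _ ξ hξ N Q hN c hc ρ₀ hρ₀ T hT b => ?_⟩
  have ht := c.time_strictMono.monotone
  obtain ⟨W, hWL, hW2, hscore⟩ := H (Q + 1) ωc hωc Ω P ξ hξ c.time ht (fun j => by
    have h0 : 0 ≤ c.time j := by rw [← c.time_zero]; exact ht (Fin.zero_le j)
    exact ⟨h0, (mul_le_mul_of_nonneg_left (ht (Fin.le_last j)) hωc.le).trans hc⟩)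
  have hX : Measurable (segmentNoise c ξ) := measurable_pi_lambda _ fun j =>
    hξ.measurable_integral (ht (Fin.castSucc_le_succ j))
  obtain ⟨h1, h2, h3, h4⟩ := outputState_properties c hX hWL hscore hρ₀ b
  have htpos := c.duration_pos
  have hNpos : (0 : ℝ) < N := by exact_mod_cast hN
  have hKs : 0 < Real.sqrt (K (Q + 1)) := Real.sqrt_pos.2 (hK _)
  have hqfi : qfi (outputState P c ξ ρ₀) b ≤ Real.sqrt (K (Q + 1)) / ωc * (c.duration * N) := by
    have e : K (Q + 1) / ωc ^ 2 = (Real.sqrt (K (Q + 1)) / ωc) ^ 2 := by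
      rw [div_pow, Real.sq_sqrt (hK _).le]
    have h5 := h3.trans (hW2.trans e.le)
    -- The information is below both `(√K / ωc)²` and `(t N)²`; the smaller of the two is at most
    -- the product of the roots.
    rcases le_total (Real.sqrt (K (Q + 1)) / ωc) (c.duration * N) with h | h
    · exact h5.trans (by rw [sq]; gcongr)
    · exact h4.trans (by rw [sq]; gcongr)
  have htot : totalQFI T c.duration (outputState P c ξ ρ₀) b ≤
      T / ωc * Real.sqrt (K (Q + 1)) * N := by
    rw [totalQFI]
    calc T / c.duration * qfi (outputState P c ξ ρ₀) b
        ≤ T / c.duration * (Real.sqrt (K (Q + 1)) / ωc * (c.duration * N)) := by gcongr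
      _ = T / ωc * Real.sqrt (K (Q + 1)) * N := by field_simp
  refine ⟨h1, h2, htot, ?_⟩
  rw [qcrb]
  have e : ωc / T * (Real.sqrt (K (Q + 1)))⁻¹ * (N : ℝ)⁻¹ =
      (T / ωc * Real.sqrt (K (Q + 1)) * N)⁻¹ := by
    rw [mul_inv, mul_inv, inv_div]
  rw [e, ENNReal.ofReal_inv_of_pos (by positivity)]
  -- Inversion is antitone on all of `ENNReal`, so vanishing information, with infinite bound, needs
  -- no separate case.
  exact ENNReal.inv_le_inv.2 (ENNReal.ofReal_le_ofReal htot)
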